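/- Let $m\ge 1$, $n=m+1$, and consider $n$ spatially separated parties: Alice, with Hilbert space $\mathbb{C}^{n+1}=\mathbb{C}^{m+2}$ and orthonormal basis $|p\rangle,|q\rangle,|1\rangle,\dots,|m\rangle$, and Bob-$i$ ($1\le i\le m$), with Hilbert space $\mathbb{C}^3$ and orthonormal basis $|p\rangle,|q\rangle,|i\rangle$. Put $|\epsilon_\pm\rangle=\frac1{\sqrt2}(|p\rangle\pm|q\rangle)$ and $|\gamma^i_\pm\rangle=\frac1{\sqrt2}(|q\rangle\pm|i\rangle)$. Let $\mathbb{G}_n\subset\mathbb{C}^{n+1}\otimes(\mathbb{C}^3)^{\otimes(n-1)}$ be the set of the $2(3m+1)$ product states $$|\zeta^0_\pm\rangle=|\epsilon_\pm\rangle_A\otimes\bigotimes_{k}|k\rangle_{B_k},\qquad |\zeta^{i,1}_\pm\rangle=|i\rangle_A|\gamma^i_\pm\rangle_{B_i}\otimes\bigotimes_{k\ne i}|k\rangle_{B_k},$$ $$|\zeta^{i,2}_\pm\rangle=|\gamma^i_\pm\rangle_A|p\rangle_{B_i}\otimes\bigotimes_{k\ne i}|k\rangle_{B_k},\qquad |\zeta^{i,3}_\pm\rangle=|p\rangle_A|\epsilon_\pm\rangle_{B_i}\otimes\bigotimes_{k\ne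 i}|k\rangle_{B_k}\qquad(1\le i\le m).$$ Fix prior probabilities $p_\zeta>0$, $\sum_{\zeta\in\mathbb{G}_n}p_\zeta=1$ (for instance uniform ones). In the task $\tau_n$ a single copy of a state $|\zeta\rangle$, drawn from $\mathbb{G}_n$ with probability $p_\zeta$, is distributed among the parties, who have to identify it by local operations and classical communication (LOCC), possibly assisted by a shared resource state $x$. The payoff $\mathcal{P}_{\tau_n}(x)$ is the supremum, over all finite-round LOCC protocols acting on $|\zeta\rangle\langle\zeta|\otimes x$, of the probability of a correct identification, and $x\succ_{\tau_n}y$ means $\mathcal{P}_{\tau_n}(x)>\mathcal{P}_{\tau_n}(y)$. Then $|g_n\rangle\succ_{\tau_n}\rho$, where $|g_n\rangle=\frac1{\sqrt2}(|0\rangle^{\otimes n}+|1\rangle^{\otimes n})$ is the $n$-qubit GHZ state with one qubit held by each party, and $\rho$ is any density operator on $\bigotimes_{j=1}^{n-1}\mathbb{C}^{d_j}$ with arbitrary local dimensions $d_j$, whose $n-1$ subsystems are distributed in an arbitrary way among the $n$ parties (in particular, one each to any $n-1$ of them). -/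

import Mathlib

open scoped Matrix BigOperators ComplexOrder

noncomputable section

/-! ### Quantum states -/

/-- Density operators on the finite-dimensional Hilbert space with orthonormal basis `S`. -/
def IsDensity {S : Type} [Fintype S] (ρ : Matrix S S ℂ) : Prop :=
  ρ.PosSemidef ∧ ρ.trace = 1

/-- The rank-one operator `|v⟩⟨v|`. -/
def pureState {S : Type} (v : S → ℂ) : Matrix S S ℂ :=
  Matrix.vecMulVec v (star v)

/-! ### LOCC protocols

The party `i` of a finite set `ι` of parties holds a Hilbert space with orthonormal basis `H i`;
the joint Hilbert space has the product basis `∀ i, H i`. -/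

/-- The tensor product of the local operators `K i`. -/
def tensorOp {ι : Type} [Fintype ι] {H H' : ι → Type}
    (K : ∀ i, Matrix (H' i) (H i) ℂ) : Matrix (∀ i, H' i) (∀ i, H i) ℂ :=
  Matrix.of fun x y => ∏ i, K i (x i) (y i)

/-- Finite-round LOCC protocols that end with the announcement of an element of `X`.
In a round every party `i` performs a local measurement with Kraus operators `K i a`, where
`a` runs over `Fin (k i)`, from its current space to a space of some dimension `e i` (ancillas can
be added or discarded); all outcomes are broadcast, and the rest of the protocol may depend on
them. A party is idle in a round if it has the identity as its only Kraus operator. -/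
inductive LOCC (ι : Type) (X : Type) :
    (H : ι → Type) → [∀ i, Fintype (H i)] → [∀ i, DecidableEq (H i)] → Type 1
  | guess {H : ι → Type} [∀ i, Fintype (H i)] [∀ i, DecidableEq (H i)] (x : X) : LOCC ι X H
  | round {H : ι → Type} [∀ i, Fintype (H i)] [∀ i, DecidableEq (H i)]
      (k e : ι → ℕ)
      (K : ∀ i, Fin (k i) → Matrix (Fin (e i)) (H i) ℂ)
      (hK : ∀ i, ∑ a, (K i a)ᴴ * K i a = 1)
      (next : (∀ i, Fin (k i)) → LOCC ι X (fun i => Fin (e i))) : LOCC ι X H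

/-- The probability that the protocol, run on the (possibly subnormalized) state `σ`, ends with
the announcement of `x`. -/
def LOCC.prob {ι X : Type} [Fintype ι] [DecidableEq ι] [DecidableEq X] :
    {H : ι → Type} → [∀ i, Fintype (H i)] → [∀ i, DecidableEq (H i)] →
      LOCC ι X H → Matrix (∀ i, H i) (∀ i, H i) ℂ → X → ℝ
  | _, _, _, LOCC.guess y, σ, x => if y = x then σ.trace.re else 0
  | _, _, _, LOCC.round k _ K _ next, σ, x =>
      ∑ a : (∀ i, Fin (k i)),
        LOCC.prob (next a)
          (tensorOp (fun i => K i (a i)) * σ * (tensorOp (fun i => K i (a i)))ᴴ) x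

/-! ### Local state discrimination with a shared resource state -/

/-- Basis of the space of party `j`: its share, of dimension `D j`, of the state to be identified,
and those subsystems `s` of the resource state, of dimension `d s`, whose holder `own s` is `j`. -/
abbrev PartySpace {ι S : Type} (D : ι → ℕ) (own : S → ι) (d : S → ℕ) (j : ι) : Type :=
  Fin (D j) × (∀ s : {s : S // own s = j}, Fin (d s))

/-- The joint state `|ψ⟩⟨ψ| ⊗ ρ`, with its tensor factors arranged party by party. -/
def jointState {ι S : Type} {D : ι → ℕ} {d : S → ℕ} (ψ : (∀ j, Fin (D j)) → ℂ)
    (own : S → ι) (ρ : Matrix (∀ s, Fin (d s)) (∀ s, Fin (d s)) ℂ) :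
    Matrix (∀ j, PartySpace D own d j) (∀ j, PartySpace D own d j) ℂ :=
  Matrix.of fun x y =>
    pureState ψ (fun j => (x j).1) (fun j => (y j).1) *
      ρ (fun s => (x (own s)).2 ⟨s, rfl⟩) (fun s => (y (own s)).2 ⟨s, rfl⟩)

/-- The payoff of the task of identifying by LOCC a state drawn from the ensemble `{p x, ψ x}`, one
copy being given, with the resource state `ρ` whose subsystem `s` is held by the party `own s`:
the supremum over all LOCC protocols of the probability of a correct identification. -/
def payoff {ι S X : Type} [Fintype ι] [DecidableEq ι] [Fintype S] [DecidableEq S]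
    [Fintype X] [DecidableEq X]
    {D : ι → ℕ} {d : S → ℕ} (p : X → ℝ) (ψ : X → (∀ j, Fin (D j)) → ℂ)
    (own : S → ι) (ρ : Matrix (∀ s, Fin (d s)) (∀ s, Fin (d s)) ℂ) : ℝ :=
  ⨆ P : LOCC ι X (PartySpace D own d), ∑ x, p x * P.prob (jointState (ψ x) own ρ) x

/-! ### The GHZ state -/

/-- The `n`-qubit state `(|0…0⟩ + |1…1⟩)/√2`. -/
def ghz (n : ℕ) : (Fin n → Fin 2) → ℂ := fun y =>
  ((Real.sqrt 2 : ℝ) : ℂ)⁻¹ *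
    ((if ∀ j, y j = 0 then 1 else 0) + (if ∀ j, y j = 1 then 1 else 0))

/-! ### The set of product states

There are `m + 1` parties: Alice is party `0` and Bob-`i` is party `i.succ`. Alice has the basis
`|p⟩, |q⟩, |1⟩, …, |m⟩`, in this order, and Bob-`i` the basis `|p⟩, |q⟩, |i⟩`. Bobs are numbered
from `0` here, so that `|i⟩` is Alice's basis vector number `i + 2`. -/

/-- The local dimensions `m + 2, 3, …, 3`. -/
def gDim (m : ℕ) : Fin (m + 1) → ℕ := Fin.cases (m + 2) (fun _ => 3)

/-- The basis vector number `a` of `ℂ ^ D`. -/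
def ket (D a : ℕ) : Fin D → ℂ := fun x => if x.val = a then 1 else 0

/-- `(|a⟩ ± |b⟩)/√2`, with the sign `+` for `true`. -/
def ketPM (D a b : ℕ) (s : Bool) : Fin D → ℂ := fun x =>
  ((Real.sqrt 2 : ℝ) : ℂ)⁻¹ * (ket D a x + (if s then 1 else -1) * ket D b x)

/-- The names `0`, `(i,1)`, `(i,2)`, `(i,3)` of the pairs of states. -/
inductive GLabel (m : ℕ) : Type
  | zero : GLabel m
  | one (i : Fin m) : GLabel m
  | two (i : Fin m) : GLabel m
  | three (i : Fin m) : GLabel m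
  deriving DecidableEq, Fintype

/-- The local state of party `j` in the product state with the given name and sign. -/
def gLocal (m : ℕ) (l : GLabel m) (s : Bool) (j : Fin (m + 1)) : Fin (gDim m j) → ℂ :=
  match l with
  | .zero => Fin.cases (motive := fun j => Fin (gDim m j) → ℂ)
      (ketPM (m + 2) 0 1 s) (fun _ => ket 3 2) j
  | .one i => Fin.cases (motive := fun j => Fin (gDim m j) → ℂ)
      (ket (m + 2) (i.val + 2)) (fun k => if k = i then ketPM 3 1 2 s else ket 3 2) j
  | .two i => Fin.cases (motive := fun j => Fin (gDim m j) → ℂ)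
      (ketPM (m + 2) 1 (i.val + 2) s) (fun k => if k = i then ket 3 0 else ket 3 2) j
  | .three i => Fin.cases (motive := fun j => Fin (gDim m j) → ℂ)
      (ket (m + 2) 0) (fun k => if k = i then ketPM 3 0 1 s else ket 3 2) j

/-- The product states of the set, indexed by name and sign. -/
def gState (m : ℕ) (x : GLabel m × Bool) : (∀ j, Fin (gDim m j)) → ℂ :=
  fun y => ∏ j, gLocal m x.1 x.2 j (y j)

end


/-!
In the grid whose rows are Alice's `|p⟩, |q⟩, |i⟩` and whose columns are Bob-`i`'s
`|p⟩, |q⟩, |i⟩`, the pairs `0`, `(i,1)`, `(i,2)`, `(i,3)` are four dominoes around the centre. If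
Bob-`i` holds no share of the resource, the nine cells remain products of a row vector of the others
and a column vector of Bob-`i` throughout a protocol. An outcome that shrinks the two cells of a
domino by different factors destroys the orthogonality of the corresponding pair, and without such
mismatches all nine weights remain comparable, so that no domino is ever excluded. The mismatch,
joined with a multiple of the total weight while neighbouring norms stay within a factor of two, is
a potential which does not decrease in a round and bounds the error from below at the end. If Alice
is the one without a share, the grid is turned by a right angle.

With the GHZ state, binary local data can be correlated coherently with the common value of the
qubits. Alice compares whether her share lies outside the span of `|p⟩` and `|q⟩` with her qubit.
Relative to her outcome each Bob-`i` learns whether the name is `(i,2)` or `(i,3)`, and then Alice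
reads off the rest of the name. The surviving pair consists of the eigenvectors, for the eigenvalues
`1` and `-1`, of a product of local involutions which exchange its two product vectors, so the
product of the signs that the parties measure identifies the state.
-/

section TensorOp

variable {ι : Type} [Fintype ι] {H H' H'' : ι → Type}

theorem tensorOp_mul [DecidableEq ι] [∀ i, Fintype (H' i)] (K : ∀ i, Matrix (H'' i) (H' i) ℂ)
    (L : ∀ i, Matrix (H' i) (H i) ℂ) :
    tensorOp K * tensorOp L = tensorOp fun i => K i * L i := by
  ext x y
  simp only [tensorOp, Matrix.mul_apply, Matrix.of_apply, ← Finset.prod_mul_distrib]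
  rw [Finset.prod_univ_sum, Fintype.piFinset_univ]

theorem tensorOp_conjTranspose (K : ∀ i, Matrix (H' i) (H i) ℂ) :
    (tensorOp K)ᴴ = tensorOp fun i => (K i)ᴴ := by
  ext x y
  simp [tensorOp, Matrix.conjTranspose_apply]

theorem tensorOp_diagonal [∀ i, DecidableEq (H i)] (w : ∀ i, H i → ℂ) :
    tensorOp (fun i => Matrix.diagonal (w i)) = Matrix.diagonal fun y => ∏ i, w i (y i) := by
  ext y z
  simp only [tensorOp, Matrix.of_apply, Matrix.diagonal_apply]
  split_ifs with h
  · simp only [h, if_true]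
  · obtain ⟨i, hi⟩ := Function.ne_iff.1 h
    exact Finset.prod_eq_zero (Finset.mem_univ i) (if_neg hi)

theorem tensorOp_one [∀ i, DecidableEq (H i)] :
    tensorOp (fun i => (1 : Matrix (H i) (H i) ℂ)) = 1 := by
  simp only [← Matrix.diagonal_one, tensorOp_diagonal, Finset.prod_const_one]

theorem tensorOp_permMatrix [∀ i, DecidableEq (H i)] (τ : ∀ i, Equiv.Perm (H i)) :
    tensorOp (fun i => (τ i).permMatrix ℂ) = Equiv.Perm.permMatrix ℂ (Equiv.piCongrRight τ) := by
  ext y z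
  simp [tensorOp, PEquiv.toMatrix_apply, Finset.prod_ite_zero, funext_iff]

theorem tensorOp_smul (c : ι → ℂ) (K : ∀ i, Matrix (H' i) (H i) ℂ) :
    (tensorOp fun i => c i • K i) = (∏ i, c i) • tensorOp K := by
  ext x y
  simp [tensorOp, Finset.prod_mul_distrib]

variable {O : ι → Type} [∀ i, Fintype (O i)] [DecidableEq ι]

theorem sum_tensorOp (M : ∀ i, O i → Matrix (H' i) (H i) ℂ) :
    ∑ a : (∀ i, O i), tensorOp (fun i => M i (a i)) = tensorOp fun i => ∑ a, M i a := by
  ext x y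
  simp only [tensorOp, Matrix.of_apply, Matrix.sum_apply]
  rw [Finset.prod_univ_sum, Fintype.piFinset_univ]

theorem sum_conjTranspose_tensorOp_mul_tensorOp [∀ i, Fintype (H' i)] [∀ i, DecidableEq (H i)]
    (K : ∀ i, O i → Matrix (H' i) (H i) ℂ) (hK : ∀ i, ∑ a, (K i a)ᴴ * K i a = 1) :
    ∑ a : (∀ i, O i), (tensorOp fun i => K i (a i))ᴴ * (tensorOp fun i => K i (a i)) = 1 := by
  simp only [tensorOp_conjTranspose, tensorOp_mul]
  rw [sum_tensorOp fun i a => (K i a)ᴴ * K i a]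
  simp only [hK, tensorOp_one]

end TensorOp

section PlusMinus

/-- The sign `±1` encoded by a truth value, `+` for `true`. -/
def boolSign (s : Bool) : ℂ := if s then 1 else -1

theorem boolSign_mul_self (s : Bool) : boolSign s * boolSign s = 1 := by
  cases s <;> simp [boolSign]

theorem norm_boolSign (s : Bool) : ‖boolSign s‖ = 1 := by
  cases s <;> simp [boolSign]

theorem exists_boolSign_eq_prod {ι : Type} [Fintype ι] (a : ι → Bool) :
    ∃ t, boolSign t = ∏ i, boolSign (a i) := by
  have hsq : (∏ i, boolSign (a i)) * ∏ i, boolSign (a i) = 1 := by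
    simp only [← Finset.prod_mul_distrib, boolSign_mul_self, Finset.prod_const_one]
  rcases mul_self_eq_one_iff.1 hsq with h | h
  · exact ⟨true, h.symm⟩
  · exact ⟨false, h.symm⟩

variable {E F : Type} [AddCommGroup E] [Module ℂ E] [AddCommGroup F] [Module ℂ F]

/-- The normalized combinations `(u ± v) / √2`. -/
noncomputable def pmComb (u v : E) (s : Bool) : E :=
  ((Real.sqrt 2 : ℝ) : ℂ)⁻¹ • (u + boolSign s • v)

theorem map_pmComb (f : E →ₗ[ℂ] F) (u v : E) (s : Bool) :
    f (pmComb u v s) = pmComb (f u) (f v) s := by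
  simp only [pmComb, map_smul, map_add]

theorem pmComb_swap (u v : E) (s : Bool) : pmComb v u s = boolSign s • pmComb u v s := by
  rw [pmComb, pmComb, smul_comm (boolSign s), smul_add (boolSign s), smul_smul (boolSign s),
    boolSign_mul_self, one_smul, add_comm]

theorem inv_sqrt_two_mul_self : ((Real.sqrt 2 : ℝ) : ℂ)⁻¹ * ((Real.sqrt 2 : ℝ) : ℂ)⁻¹ = 1 / 2 := by
  rw [← mul_inv, ← Complex.ofReal_mul, Real.mul_self_sqrt zero_le_two]
  norm_num

end PlusMinus

section Norm

variable {E : Type} [SeminormedAddCommGroup E] [NormedSpace ℂ E]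

theorem norm_pmComb_sq (u v : E) (s : Bool) :
    ‖pmComb u v s‖ ^ 2 = 1 / 2 * ‖u + boolSign s • v‖ ^ 2 := by
  rw [pmComb, norm_smul, mul_pow, ← norm_pow, pow_two, inv_sqrt_two_mul_self]
  norm_num

theorem sq_norm_sub_norm_le_norm_pmComb_sq (u v : E) (s : Bool) :
    1 / 2 * (‖u‖ - ‖v‖) ^ 2 ≤ ‖pmComb u v s‖ ^ 2 := by
  have h := abs_norm_sub_norm_le u (-(boolSign s • v))
  rw [norm_neg, norm_smul, norm_boolSign, one_mul, sub_neg_eq_add] at h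
  rw [norm_pmComb_sq, ← sq_abs]
  gcongr

theorem norm_sq_le_norm_pmComb_sq_add (u v : E) :
    ‖u‖ ^ 2 ≤ ‖pmComb u v true‖ ^ 2 + ‖pmComb u v false‖ ^ 2 := by
  have h := norm_add_le (u + v) (u - v)
  rw [add_add_sub_cancel, ← two_smul ℝ u, norm_smul, Real.norm_two] at h
  have h2 := pow_le_pow_left₀ (by positivity) h 2
  rw [norm_pmComb_sq, norm_pmComb_sq]
  simp only [boolSign, if_true, Bool.false_eq_true, if_false, one_smul, neg_smul, ← sub_eq_add_neg]
  nlinarith [sq_nonneg (‖u + v‖ - ‖u - v‖)]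

end Norm

section Frobenius

open scoped Matrix.Norms.Frobenius

variable {A B κ : Type} [Fintype A] [Fintype B] [Fintype κ]

theorem frobenius_norm_sq (W : Matrix A κ ℂ) : ‖W‖ ^ 2 = ∑ a, ∑ k, ‖W a k‖ ^ 2 := by
  simp only [Matrix.frobenius_norm_def, ← Real.sqrt_eq_rpow, Real.rpow_two]
  exact Real.sq_sqrt (by positivity)

theorem trace_mul_conjTranspose_re (W : Matrix A κ ℂ) : (W * Wᴴ).trace.re = ‖W‖ ^ 2 := by
  simp only [frobenius_norm_sq, Matrix.trace, Matrix.diag_apply, Matrix.mul_apply, Complex.re_sum,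
    Matrix.conjTranspose_apply, Complex.star_def, Complex.mul_conj, Complex.ofReal_re,
    Complex.normSq_eq_norm_sq]

end Frobenius

section LOCC

variable {ι X : Type} [Fintype ι] [DecidableEq ι] [DecidableEq X]
  {H : ι → Type} [∀ i, Fintype (H i)] [∀ i, DecidableEq (H i)]

theorem sum_trace_mul_mul_conjTranspose {A B O : Type} [Fintype A] [DecidableEq A] [Fintype B]
    [Fintype O] (T : O → Matrix B A ℂ) (hT : ∑ a, (T a)ᴴ * T a = 1) (σ : Matrix A A ℂ) :
    ∑ a, (T a * σ * (T a)ᴴ).trace = σ.trace := by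
  have h : ∀ a, (T a * σ * (T a)ᴴ).trace = ((T a)ᴴ * T a * σ).trace := fun a => by
    rw [Matrix.trace_mul_comm, Matrix.mul_assoc]
  simp only [h]
  rw [← Matrix.trace_sum, ← Matrix.sum_mul, hT, Matrix.one_mul]

theorem LOCC.prob_le_trace (P : LOCC ι X H) {σ : Matrix (∀ i, H i) (∀ i, H i) ℂ}
    (hσ : σ.PosSemidef) (x : X) : P.prob σ x ≤ σ.trace.re := by
  induction P with
  | guess y =>
    rw [LOCC.prob]
    split_ifs
    · exact le_rfl
    · exact (Complex.nonneg_iff.1 hσ.trace_nonneg).1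
  | round k e K hK next ih =>
    rw [LOCC.prob, ← sum_trace_mul_mul_conjTranspose _
      (sum_conjTranspose_tensorOp_mul_tensorOp K hK), Complex.re_sum]
    exact Finset.sum_le_sum fun a _ => ih a (hσ.mul_mul_conjTranspose_same _)

/-- The sum over `y` of the probabilities that the protocol `P`, run on `σ y`, fails to announce
`lab y`. -/
noncomputable def LOCC.error {Y : Type} [Fintype Y] (P : LOCC ι X H) (lab : Y → X)
    (σ : Y → Matrix (∀ i, H i) (∀ i, H i) ℂ) : ℝ :=
  ∑ y, ((σ y).trace.re - P.prob (σ y) (lab y))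

theorem LOCC.error_guess {Y : Type} [Fintype Y] (x : X) (lab : Y → X)
    (σ : Y → Matrix (∀ i, H i) (∀ i, H i) ℂ) :
    (LOCC.guess x : LOCC ι X H).error lab σ = ∑ y, if x = lab y then 0 else (σ y).trace.re := by
  refine Finset.sum_congr rfl fun y _ => ?_
  rw [LOCC.prob]
  split_ifs <;> simp

theorem LOCC.error_round {Y : Type} [Fintype Y] (k e : ι → ℕ)
    (K : ∀ i, Fin (k i) → Matrix (Fin (e i)) (H i) ℂ) (hK : ∀ i, ∑ a, (K i a)ᴴ * K i a = 1)
    (next : (∀ i, Fin (k i)) → LOCC ι X (fun i => Fin (e i))) (lab : Y → X)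
    (σ : Y → Matrix (∀ i, H i) (∀ i, H i) ℂ) :
    (LOCC.round k e K hK next).error lab σ = ∑ a : (∀ i, Fin (k i)), (next a).error lab fun y =>
      tensorOp (fun i => K i (a i)) * σ y * (tensorOp fun i => K i (a i))ᴴ := by
  simp only [LOCC.error]
  rw [Finset.sum_comm]
  refine Finset.sum_congr rfl fun y _ => ?_
  rw [LOCC.prob, ← sum_trace_mul_mul_conjTranspose _
    (sum_conjTranspose_tensorOp_mul_tensorOp K hK), Complex.re_sum, Finset.sum_sub_distrib]

theorem LOCC.error_comp_le {Y Z : Type} [Fintype Y] [Fintype Z] (P : LOCC ι X H) {f : Y → Z}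
    (hf : Function.Injective f) (lab : Z → X) {σ : Z → Matrix (∀ i, H i) (∀ i, H i) ℂ}
    (hσ : ∀ z, (σ z).PosSemidef) : P.error (lab ∘ f) (σ ∘ f) ≤ P.error lab σ := by
  classical
  simp only [LOCC.error, Function.comp_apply]
  rw [← Finset.sum_image (f := fun z => (σ z).trace.re - P.prob (σ z) (lab z)) hf.injOn]
  exact Finset.sum_le_sum_of_subset_of_nonneg (Finset.subset_univ _)
    fun z _ _ => sub_nonneg.2 (P.prob_le_trace (hσ z) _)

end LOCC

section LoneParty

open scoped Matrix.Norms.Frobenius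

variable {ι κ : Type} [Fintype ι] [DecidableEq ι] {H H' : ι → Type}

/-- The tensor product of a vector `β` of the party `j` with a matrix `V` whose rows belong to the
other parties. -/
def loneTensor (j : ι) (V : Matrix (∀ i : {i // i ≠ j}, H i) κ ℂ) (β : Matrix (H j) Unit ℂ) :
    Matrix (∀ i, H i) κ ℂ :=
  Matrix.of fun x k => V (fun i => x i) k * β (x j) ()

theorem sum_pi_eq_sum_sum_ne {M : Type} [AddCommMonoid M] [∀ i, Fintype (H i)] (j : ι)
    (g : (∀ i : {i // i ≠ j}, H i) → H j → M) :
    ∑ x : (∀ i, H i), g (fun i => x i) (x j) = ∑ r, ∑ b, g r b := by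
  rw [Finset.sum_comm, ← Fintype.sum_prod_type', ← (Equiv.piSplitAt j H).sum_comp]
  rfl

theorem tensorOp_mul_loneTensor [∀ i, Fintype (H i)] (j : ι) (K : ∀ i, Matrix (H' i) (H i) ℂ)
    (V : Matrix (∀ i : {i // i ≠ j}, H i) κ ℂ) (β : Matrix (H j) Unit ℂ) :
    tensorOp K * loneTensor j V β
      = loneTensor j (tensorOp (fun i : {i // i ≠ j} => K i) * V) (K j * β) := by
  ext x k
  simp only [Matrix.mul_apply, loneTensor, Matrix.of_apply, tensorOp]
  rw [Finset.sum_mul_sum, ← sum_pi_eq_sum_sum_ne j]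
  refine Finset.sum_congr rfl fun y _ => ?_
  rw [Fintype.prod_eq_mul_prod_subtype_ne _ j]
  ring

theorem norm_loneTensor [∀ i, Fintype (H i)] [Fintype κ] (j : ι)
    (V : Matrix (∀ i : {i // i ≠ j}, H i) κ ℂ) (β : Matrix (H j) Unit ℂ) :
    ‖loneTensor j V β‖ = ‖V‖ * ‖β‖ := by
  rw [← sq_eq_sq₀ (norm_nonneg _) (by positivity), mul_pow, frobenius_norm_sq,
    frobenius_norm_sq, frobenius_norm_sq, Finset.sum_mul_sum, ← sum_pi_eq_sum_sum_ne j]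
  simp only [loneTensor, Matrix.of_apply, norm_mul, mul_pow, Finset.univ_unique,
    Finset.sum_singleton, Finset.sum_mul, PUnit.default_eq_unit]

theorem sum_norm_sq_mul {A B O : Type} [Fintype A] [DecidableEq A] [Fintype B] [Fintype κ]
    [Fintype O] (T : O → Matrix B A ℂ) (hT : ∑ a, (T a)ᴴ * T a = 1) (W : Matrix A κ ℂ) :
    ∑ a, ‖T a * W‖ ^ 2 = ‖W‖ ^ 2 := by
  simp only [← trace_mul_conjTranspose_re]
  rw [← sum_trace_mul_mul_conjTranspose T hT, Complex.re_sum]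
  simp only [Matrix.conjTranspose_mul, Matrix.mul_assoc]

end LoneParty

section DominoPotential

/-- The first cells of the four tiles. The tiles of the three by three grid are pairs of adjacent
cells that surround the centre; the cell `(u, w)` is in row `u` and column `w`. -/
def dominoFst : Fin 4 → Fin 3 × Fin 3 := ![(0, 2), (2, 1), (1, 0), (0, 0)]

/-- The second cells of the four tiles. -/
def dominoSnd : Fin 4 → Fin 3 × Fin 3 := ![(1, 2), (2, 2), (2, 0), (0, 1)]

/-- The squared mismatch of the weights `x u * y w` across the four tiles. -/
noncomputable def dominoDefect (x y : Fin 3 → ℝ) : ℝ :=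
  ∑ l, 1 / 2 * (x (dominoFst l).1 * y (dominoFst l).2 - x (dominoSnd l).1 * y (dominoSnd l).2) ^ 2

/-- Neighbouring weights differ by a factor of at most two. -/
def NormBalanced (x : Fin 3 → ℝ) : Prop :=
  x 0 ≤ 2 * x 1 ∧ x 1 ≤ 2 * x 0 ∧ x 1 ≤ 2 * x 2 ∧ x 2 ≤ 2 * x 1

open Classical in
/-- The lower bound for the error of a protocol on the domino states, as a function of the norms of
the local vectors: the mismatch across the tiles, and also a multiple of the total weight as long
as the norms are balanced. The constant is `546 = 2 * 13 * 21`, the product of the factors in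
`dominoDefect_eq`, `sum_sq_le_of_not_normBalanced` and `NormBalanced.sum_sq_le`. -/
noncomputable def dominoPotential (x y : Fin 3 → ℝ) : ℝ :=
  max (dominoDefect x y)
    (if NormBalanced x ∧ NormBalanced y then (∑ u, x u ^ 2) * (∑ w, y w ^ 2) / 546 else 0)

theorem dominoDefect_eq (x y : Fin 3 → ℝ) :
    dominoDefect x y = 1 / 2 * (y 2 ^ 2 * (x 0 - x 1) ^ 2 + x 2 ^ 2 * (y 1 - y 2) ^ 2 +
      y 0 ^ 2 * (x 1 - x 2) ^ 2 + x 0 ^ 2 * (y 0 - y 1) ^ 2) := by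
  simp only [dominoDefect, dominoFst, dominoSnd, Fin.sum_univ_four, Matrix.cons_val]
  ring

theorem normBalanced_comp_rev {x : Fin 3 → ℝ} : NormBalanced (x ∘ Fin.rev) ↔ NormBalanced x := by
  simp only [NormBalanced, Function.comp_apply, show Fin.rev (0 : Fin 3) = 2 from rfl,
    show Fin.rev (1 : Fin 3) = 1 from rfl, show Fin.rev (2 : Fin 3) = 0 from rfl]
  tauto

theorem dominoPotential_rotate (x y : Fin 3 → ℝ) :
    dominoPotential y (x ∘ Fin.rev) = dominoPotential x y := by
  have hdefect : dominoDefect y (x ∘ Fin.rev) = dominoDefect x y := by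
    simp only [dominoDefect_eq, Function.comp_apply, show Fin.rev (0 : Fin 3) = 2 from rfl,
      show Fin.rev (1 : Fin 3) = 1 from rfl, show Fin.rev (2 : Fin 3) = 0 from rfl]
    ring
  have hsum : ∑ u, (x ∘ Fin.rev) u ^ 2 = ∑ u, x u ^ 2 :=
    Equiv.sum_comp Fin.revPerm fun u => x u ^ 2
  rw [dominoPotential, hdefect, hsum, mul_comm (∑ u, y u ^ 2)]
  congr 2
  rw [normBalanced_comp_rev, and_comm]

theorem sub_sq_le_sum_sub_sq {O : Type} [Fintype O] (f g : O → ℝ) {F G : ℝ} (hF : 0 ≤ F)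
    (hG : 0 ≤ G) (hf : ∑ a, f a ^ 2 = F ^ 2) (hg : ∑ a, g a ^ 2 = G ^ 2) :
    (F - G) ^ 2 ≤ ∑ a, (f a - g a) ^ 2 := by
  have hinner : ∑ a, f a * g a ≤ F * G := by
    refine (abs_le_of_sq_le_sq' ?_ (mul_nonneg hF hG)).2
    rw [mul_pow, ← hf, ← hg]
    exact Finset.sum_mul_sq_le_sq_mul_sq _ _ _
  have hexpand : ∑ a, (f a - g a) ^ 2 = F ^ 2 - 2 * ∑ a, f a * g a + G ^ 2 := by
    rw [← hf, ← hg, Finset.mul_sum, ← Finset.sum_sub_distrib, ← Finset.sum_add_distrib]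
    exact Finset.sum_congr rfl fun a _ => by ring
  rw [hexpand]
  linarith

theorem NormBalanced.sum_sq_le {x : Fin 3 → ℝ} (h : NormBalanced x) (hx : 0 ≤ x) (u : Fin 3) :
    ∑ v, x v ^ 2 ≤ 21 * x u ^ 2 := by
  have e1 := pow_le_pow_left₀ (hx 0) h.1 2
  have e2 := pow_le_pow_left₀ (hx 1) h.2.1 2
  have e3 := pow_le_pow_left₀ (hx 1) h.2.2.1 2
  have e4 := pow_le_pow_left₀ (hx 2) h.2.2.2 2
  rw [Fin.sum_univ_three]
  fin_cases u <;> simp only [Fin.zero_eta, Fin.mk_one, Fin.reduceFinMk] <;>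
    linarith [sq_nonneg (x 0), sq_nonneg (x 1), sq_nonneg (x 2)]

theorem sum_sq_le_of_two_mul_lt {a b c : ℝ} (ha : 0 ≤ a) (hb : 0 ≤ b)
    (h : 2 * b < a ∨ 2 * a < b) :
    a ^ 2 + b ^ 2 + c ^ 2 ≤ 13 * ((a - b) ^ 2 + (b - c) ^ 2) := by
  rcases h with h | h
  · nlinarith [mul_nonneg ha hb, mul_nonneg (sub_pos.2 h).le hb, mul_nonneg (sub_pos.2 h).le ha,
      sq_nonneg (2 * b - c)]
  · nlinarith [mul_nonneg ha hb, mul_nonneg (sub_pos.2 h).le hb, mul_nonneg (sub_pos.2 h).le ha,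
      sq_nonneg (13 * b - 12 * c)]

theorem sum_sq_le_of_not_normBalanced {x : Fin 3 → ℝ} (h : ¬NormBalanced x) (hx : 0 ≤ x) :
    ∑ v, x v ^ 2 ≤ 13 * ((x 0 - x 1) ^ 2 + (x 1 - x 2) ^ 2) := by
  rw [Fin.sum_univ_three]
  by_cases h01 : 2 * x 1 < x 0 ∨ 2 * x 0 < x 1
  · exact sum_sq_le_of_two_mul_lt (hx 0) (hx 1) h01
  · have h21 : 2 * x 1 < x 2 ∨ 2 * x 2 < x 1 := by
      by_contra hc
      push Not at h01 hc
      exact h ⟨h01.1, h01.2, hc.2, hc.1⟩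
    have := sum_sq_le_of_two_mul_lt (c := x 0) (hx 2) (hx 1) h21
    linarith [sub_sq_comm (x 2) (x 1), sub_sq_comm (x 1) (x 0)]

theorem sum_sq_mul_le_dominoPotential {x y : Fin 3 → ℝ} (hx : 0 ≤ x) (hy : 0 ≤ y)
    (hby : NormBalanced y) : (∑ u, x u ^ 2) * (∑ w, y w ^ 2) / 546 ≤ dominoPotential x y := by
  by_cases hbx : NormBalanced x
  · rw [dominoPotential, if_pos ⟨hbx, hby⟩]
    exact le_max_right _ _
  · refine le_trans ?_ (le_max_left _ _)
    have h0 := mul_le_mul_of_nonneg_right (hby.sum_sq_le hy 0) (sq_nonneg (x 1 - x 2))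
    have h2 := mul_le_mul_of_nonneg_right (hby.sum_sq_le hy 2) (sq_nonneg (x 0 - x 1))
    have h13 := mul_le_mul_of_nonneg_right (sum_sq_le_of_not_normBalanced hbx hx)
      (show 0 ≤ ∑ w, y w ^ 2 by positivity)
    rw [dominoDefect_eq]
    linarith [show 0 ≤ x 2 ^ 2 * (y 1 - y 2) ^ 2 by positivity,
      show 0 ≤ x 0 ^ 2 * (y 0 - y 1) ^ 2 by positivity]

theorem le_dominoPotential_of_mul_eq_one {x y : Fin 3 → ℝ} (hx : 0 ≤ x) (hy : 0 ≤ y)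
    (h : ∀ u w, x u * y w = 1) : 9 / 546 ≤ dominoPotential x y := by
  have hconst : ∀ w, y w = y 0 := fun w =>
    mul_left_cancel₀ (left_ne_zero_of_mul_eq_one (h 0 0)) ((h 0 w).trans (h 0 0).symm)
  have hbal : NormBalanced y := by
    have h0 : 0 ≤ y 0 := hy 0
    simp only [NormBalanced, hconst 1, hconst 2]
    exact ⟨by linarith, by linarith, by linarith, by linarith⟩
  refine le_trans (le_of_eq ?_) (sum_sq_mul_le_dominoPotential hx hy hbal)
  simp only [Finset.sum_mul_sum, ← mul_pow, h]
  norm_num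

variable {O : Type} [Fintype O]

theorem dominoDefect_le_sum (f : O → Fin 3 → ℝ) {x y : Fin 3 → ℝ} (hx : 0 ≤ x) (hy : 0 ≤ y)
    (hf : ∀ u, ∑ a, f a u ^ 2 = x u ^ 2) : dominoDefect x y ≤ ∑ a, dominoDefect (f a) y := by
  simp only [dominoDefect]
  rw [Finset.sum_comm]
  simp only [← Finset.mul_sum]
  have hcell : ∀ u w, ∑ a, (f a u * y w) ^ 2 = (x u * y w) ^ 2 := fun u w => by
    simp only [mul_pow, ← Finset.sum_mul, hf]
  gcongr with l
  exact sub_sq_le_sum_sub_sq _ _ (mul_nonneg (hx _) (hy _)) (mul_nonneg (hx _) (hy _))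
    (hcell _ _) (hcell _ _)

theorem dominoPotential_nonneg (x y : Fin 3 → ℝ) : 0 ≤ dominoPotential x y :=
  le_max_of_le_left (Finset.sum_nonneg fun _ _ => by positivity)

theorem dominoPotential_le_sum_left (f : O → Fin 3 → ℝ) {x y : Fin 3 → ℝ} (hf0 : ∀ a, 0 ≤ f a)
    (hx : 0 ≤ x) (hy : 0 ≤ y) (hf : ∀ u, ∑ a, f a u ^ 2 = x u ^ 2) :
    dominoPotential x y ≤ ∑ a, dominoPotential (f a) y := by
  refine max_le ((dominoDefect_le_sum f hx hy hf).trans (Finset.sum_le_sum fun a _ =>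
    le_max_left _ _)) ?_
  split_ifs with hb
  · calc (∑ u, x u ^ 2) * (∑ w, y w ^ 2) / 546
        = ∑ a, (∑ u, f a u ^ 2) * (∑ w, y w ^ 2) / 546 := by
          rw [← Finset.sum_div, ← Finset.sum_mul, Finset.sum_comm]
          simp only [hf]
      _ ≤ ∑ a, dominoPotential (f a) y :=
          Finset.sum_le_sum fun a _ => sum_sq_mul_le_dominoPotential (hf0 a) hy hb.2
  · exact Finset.sum_nonneg fun a _ => dominoPotential_nonneg _ _

theorem dominoPotential_le_sum_right (f : O → Fin 3 → ℝ) {x y : Fin 3 → ℝ} (hf0 : ∀ a, 0 ≤ f a)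
    (hx : 0 ≤ x) (hy : 0 ≤ y) (hf : ∀ u, ∑ a, f a u ^ 2 = y u ^ 2) :
    dominoPotential x y ≤ ∑ a, dominoPotential x (f a) := by
  simp only [← dominoPotential_rotate x]
  exact dominoPotential_le_sum_left f hf0 hy (fun u => hx u.rev) hf

end DominoPotential

section Domino

open scoped Matrix.Norms.Frobenius

/-- The eight combinations `(T c ± T c') / √2`, where `c` and `c'` are the cells of a tile. -/
noncomputable def domino {E : Type} [AddCommGroup E] [Module ℂ E] (T : Fin 3 → Fin 3 → E)
    (q : Fin 4 × Bool) : E :=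
  pmComb (T (dominoFst q.1).1 (dominoFst q.1).2) (T (dominoSnd q.1).1 (dominoSnd q.1).2) q.2

theorem map_domino {E F : Type} [AddCommGroup E] [Module ℂ E] [AddCommGroup F] [Module ℂ F]
    (f : E →ₗ[ℂ] F) (T : Fin 3 → Fin 3 → E) (q : Fin 4 × Bool) :
    f (domino T q) = domino (fun u w => f (T u w)) q :=
  map_pmComb f _ _ _

/-- The operators `|F y⟩⟨F y|`, for matrices `F y` in place of vectors. -/
def gramOp {A κ Y : Type} [Fintype κ] (F : Y → Matrix A κ ℂ) (y : Y) : Matrix A A ℂ :=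
  F y * (F y)ᴴ

variable {ι κ X : Type} [Fintype ι] [DecidableEq ι] [DecidableEq X] [Fintype κ]
  {H H' : ι → Type} [∀ i, Fintype (H i)]

theorem tensorOp_mul_gramOp_domino_mul (j : ι) (K : ∀ i, Matrix (H' i) (H i) ℂ)
    (V : Fin 3 → Matrix (∀ i : {i // i ≠ j}, H i) κ ℂ) (β : Fin 3 → Matrix (H j) Unit ℂ)
    (q : Fin 4 × Bool) :
    tensorOp K * gramOp (domino fun u w => loneTensor j (V u) (β w)) q * (tensorOp K)ᴴ =
      gramOp (domino fun u w =>
        loneTensor j (tensorOp (fun i : {i // i ≠ j} => K i) * V u) (K j * β w)) q := by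
  simp only [gramOp, ← tensorOp_mul_loneTensor j K]
  have hmap := map_domino (mulLeftLinearMap κ ℂ (tensorOp K))
    (fun u w => loneTensor j (V u) (β w)) q
  simp only [mulLeftLinearMap_apply] at hmap
  simp only [← hmap, Matrix.conjTranspose_mul, Matrix.mul_assoc]

variable [∀ i, DecidableEq (H i)]

theorem dominoDefect_le_error_guess {lab : Fin 4 × Bool → X} (hlab : Function.Injective lab)
    (x : X) (j : ι) (V : Fin 3 → Matrix (∀ i : {i // i ≠ j}, H i) κ ℂ)
    (β : Fin 3 → Matrix (H j) Unit ℂ) :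
    dominoDefect (fun u => ‖V u‖) (fun w => ‖β w‖) ≤
      (LOCC.guess x : LOCC ι X H).error lab
        (gramOp (domino fun u w => loneTensor j (V u) (β w))) := by
  rw [LOCC.error_guess, Fintype.sum_prod_type]
  simp only [gramOp, trace_mul_conjTranspose_re]
  refine Finset.sum_le_sum fun l _ => ?_
  obtain ⟨s, hs⟩ : ∃ s, x ≠ lab (l, s) := by
    by_contra! hc
    exact absurd (hlab ((hc true).symm.trans (hc false))) (by simp)
  refine le_trans ?_ (Finset.single_le_sum (fun s _ => by split_ifs <;> positivity)
    (Finset.mem_univ s))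
  rw [if_neg hs]
  simp only [← norm_loneTensor]
  exact sq_norm_sub_norm_le_norm_pmComb_sq _ _ _

theorem NormBalanced.le_error_guess {lab : Fin 4 × Bool → X} (hlab : Function.Injective lab)
    (x : X) (j : ι) {V : Fin 3 → Matrix (∀ i : {i // i ≠ j}, H i) κ ℂ}
    {β : Fin 3 → Matrix (H j) Unit ℂ} (hV : NormBalanced fun u => ‖V u‖)
    (hβ : NormBalanced fun w => ‖β w‖) :
    (∑ u, ‖V u‖ ^ 2) * (∑ w, ‖β w‖ ^ 2) / 546 ≤
      (LOCC.guess x : LOCC ι X H).error lab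
        (gramOp (domino fun u w => loneTensor j (V u) (β w))) := by
  have hcell : ∀ u w,
      (∑ u, ‖V u‖ ^ 2) * (∑ w, ‖β w‖ ^ 2) / 441 ≤ ‖loneTensor j (V u) (β w)‖ ^ 2 := fun u w => by
    have h := mul_le_mul (hV.sum_sq_le (fun u => norm_nonneg _) u)
      (hβ.sum_sq_le (fun w => norm_nonneg _) w) (by positivity) (by positivity)
    rw [norm_loneTensor, mul_pow]
    linarith
  obtain ⟨l, hl⟩ : ∃ l : Fin 4, ∀ s, x ≠ lab (l, s) := by
    by_contra! hc
    obtain ⟨s, hs⟩ := hc 0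
    obtain ⟨t, ht⟩ := hc 1
    exact absurd (hlab (hs.symm.trans ht)) (by simp)
  rw [LOCC.error_guess, Fintype.sum_prod_type]
  simp only [gramOp, trace_mul_conjTranspose_re]
  refine le_trans ?_ (Finset.single_le_sum (fun l _ => Finset.sum_nonneg fun s _ => by
    split_ifs <;> positivity) (Finset.mem_univ l))
  simp only [hl, if_false, Fintype.sum_bool]
  refine le_trans ?_ (norm_sq_le_norm_pmComb_sq_add _ _)
  refine le_trans ?_ (hcell _ _)
  gcongr
  norm_num

theorem dominoPotential_le_error {lab : Fin 4 × Bool → X} (hlab : Function.Injective lab)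
    (P : LOCC ι X H) (j : ι) (V : Fin 3 → Matrix (∀ i : {i // i ≠ j}, H i) κ ℂ)
    (β : Fin 3 → Matrix (H j) Unit ℂ) :
    dominoPotential (fun u => ‖V u‖) (fun w => ‖β w‖) ≤
      P.error lab (gramOp (domino fun u w => loneTensor j (V u) (β w))) := by
  induction P with
  | guess x =>
    have hdefect := dominoDefect_le_error_guess hlab x j V β
    refine max_le hdefect ?_
    split_ifs with hb
    · exact hb.1.le_error_guess hlab x j hb.2
    · exact le_trans (Finset.sum_nonneg fun _ _ => by positivity) hdefect
  | round k e K hK next ih =>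
    rw [LOCC.error_round]
    simp only [tensorOp_mul_gramOp_domino_mul]
    refine le_trans ?_ (Finset.sum_le_sum fun a _ => ih a _ _)
    rw [sum_pi_eq_sum_sum_ne (H := fun i => Fin (k i)) j fun r b => dominoPotential
      (fun u => ‖tensorOp (fun i : {i // i ≠ j} => K i (r i)) * V u‖) fun w => ‖K j b * β w‖]
    have hothers := sum_conjTranspose_tensorOp_mul_tensorOp (fun i : {i // i ≠ j} => K i)
      fun i => hK i
    refine (dominoPotential_le_sum_left _ (fun r u => norm_nonneg _) (fun u => norm_nonneg _)
      (fun w => norm_nonneg _) fun u => sum_norm_sq_mul _ hothers (V u)).trans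
      (Finset.sum_le_sum fun r _ => ?_)
    exact dominoPotential_le_sum_right _ (fun b w => norm_nonneg _) (fun u => norm_nonneg _)
      (fun w => norm_nonneg _) fun w => sum_norm_sq_mul (K j) (hK j) (β w)

end Domino

section PureStates

variable {A : Type} [Fintype A]

theorem isDensity_pureState {v : A → ℂ} (hv : v ⬝ᵥ star v = 1) : IsDensity (pureState v) :=
  ⟨Matrix.posSemidef_vecMulVec_self_star v, by rw [pureState, Matrix.trace_vecMulVec, hv]⟩

theorem pmComb_dotProduct_star_self {u v : A → ℂ} (hu : u ⬝ᵥ star u = 1) (hv : v ⬝ᵥ star v = 1)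
    (huv : u ⬝ᵥ star v = 0) (s : Bool) : pmComb u v s ⬝ᵥ star (pmComb u v s) = 1 := by
  have hvu : v ⬝ᵥ star u = 0 := by
    rw [Matrix.dotProduct_star, huv, star_zero]
  have hstar : star (boolSign s) = boolSign s := by cases s <;> simp [boolSign]
  have hsqrt : star (((Real.sqrt 2 : ℝ) : ℂ)⁻¹) = ((Real.sqrt 2 : ℝ) : ℂ)⁻¹ := by simp
  simp only [pmComb, star_smul, star_add, smul_dotProduct, dotProduct_smul, add_dotProduct,
    dotProduct_add, hu, hv, huv, hvu, hstar, hsqrt, smul_eq_mul]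
  linear_combination 2 * inv_sqrt_two_mul_self +
    ((Real.sqrt 2 : ℝ) : ℂ)⁻¹ * ((Real.sqrt 2 : ℝ) : ℂ)⁻¹ * boolSign_mul_self s

variable {ι : Type} [Fintype ι]

/-- The product of the basis vectors number `n k` of the parties `k`, which is `0` if one of these
numbers is out of range. -/
def basisVec (D n : ι → ℕ) : (∀ j, Fin (D j)) → ℂ := fun y => ∏ k, ket (D k) (n k) (y k)

theorem basisVec_apply (D n : ι → ℕ) (y : ∀ j, Fin (D j)) :
    basisVec D n y = if ∀ k, (y k).val = n k then 1 else 0 := by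
  simp only [basisVec, ket, Finset.prod_ite_zero, Finset.mem_univ, true_implies,
    Finset.prod_const_one]

theorem basisVec_eq_single {D n : ι → ℕ} (hn : ∀ k, n k < D k) :
    basisVec D n = Pi.single (fun k => ⟨n k, hn k⟩) 1 := by
  funext y
  simp only [basisVec_apply, Pi.single_apply, funext_iff, Fin.ext_iff]

theorem isDensity_pureState_basisVec [DecidableEq ι] {D n : ι → ℕ}
    (hn : ∀ k, n k < D k) : IsDensity (pureState (basisVec D n)) :=
  isDensity_pureState (by simp [basisVec_eq_single hn])

theorem isDensity_pureState_pmComb_basisVec [DecidableEq ι] {D n n' : ι → ℕ} (hn : ∀ k, n k < D k)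
    (hn' : ∀ k, n' k < D k) (hne : n ≠ n') (s : Bool) :
    IsDensity (pureState (pmComb (basisVec D n) (basisVec D n') s)) := by
  have hne' : (fun k => (⟨n k, hn k⟩ : Fin (D k))) ≠ fun k => ⟨n' k, hn' k⟩ := fun h =>
    hne (funext fun k => congrArg Fin.val (congrFun h k))
  refine isDensity_pureState (pmComb_dotProduct_star_self ?_ ?_ ?_ s) <;>
    simp [basisVec_eq_single hn, basisVec_eq_single hn', hne'.symm]

end PureStates

section Resource

open scoped Matrix.Norms.Frobenius Kronecker

variable {ι S κ : Type} {D : ι → ℕ} {d : S → ℕ}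

/-- The tensor product of `ψ` with a square root `C` of the resource state, arranged party by
party. -/
def resourceVec (ψ : (∀ j, Fin (D j)) → ℂ) (own : S → ι) (C : Matrix (∀ s, Fin (d s)) κ ℂ) :
    Matrix (∀ j, PartySpace D own d j) κ ℂ :=
  Matrix.of fun x k => ψ (fun j => (x j).1) * C (fun s => (x (own s)).2 ⟨s, rfl⟩) k

theorem jointState_pureState (ψ : (∀ j, Fin (D j)) → ℂ) (own : S → ι)
    (φ : (∀ s, Fin (d s)) → ℂ) :
    jointState ψ own (pureState φ) = pureState fun x =>
      ψ (fun j => (x j).1) * φ (fun s => (x (own s)).2 ⟨s, rfl⟩) := by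
  ext x y
  simp only [jointState, pureState, Matrix.of_apply, Matrix.vecMulVec_apply, Pi.star_apply,
    star_mul']
  exact mul_mul_mul_comm _ _ _ _

theorem jointState_mul_conjTranspose [Fintype κ] (ψ : (∀ j, Fin (D j)) → ℂ) (own : S → ι)
    (C : Matrix (∀ s, Fin (d s)) κ ℂ) :
    jointState ψ own (C * Cᴴ) = resourceVec ψ own C * (resourceVec ψ own C)ᴴ := by
  ext x y
  simp only [jointState, pureState, resourceVec, Matrix.of_apply, Matrix.vecMulVec_apply,
    Matrix.mul_apply, Matrix.conjTranspose_apply, Finset.mul_sum, star_mul', Pi.star_apply]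
  exact Finset.sum_congr rfl fun k _ => mul_mul_mul_comm _ _ _ _

theorem resourceVec_pmComb (u v : (∀ j, Fin (D j)) → ℂ) (s : Bool) (own : S → ι)
    (C : Matrix (∀ s, Fin (d s)) κ ℂ) :
    resourceVec (pmComb u v s) own C
      = pmComb (resourceVec u own C) (resourceVec v own C) s := by
  ext x k
  simp only [resourceVec, pmComb, Matrix.of_apply, Pi.smul_apply, Pi.add_apply, Matrix.smul_apply,
    Matrix.add_apply, smul_eq_mul]
  ring

/-- The joint basis, with the resource separated from the state to be identified. -/
def partySpaceEquiv (D : ι → ℕ) (own : S → ι) (d : S → ℕ) :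
    (∀ j, PartySpace D own d j) ≃ (∀ j, Fin (D j)) × (∀ s, Fin (d s)) where
  toFun x := (fun j => (x j).1, fun s => (x (own s)).2 ⟨s, rfl⟩)
  invFun y := fun j => (y.1 j, fun s => y.2 s)
  left_inv x := by
    funext j
    refine Prod.ext rfl (funext fun s => ?_)
    obtain ⟨s, rfl⟩ := s
    rfl
  right_inv y := rfl

theorem jointState_eq_submatrix (ψ : (∀ j, Fin (D j)) → ℂ) (own : S → ι)
    (ρ : Matrix (∀ s, Fin (d s)) (∀ s, Fin (d s)) ℂ) :
    jointState ψ own ρ = (pureState ψ ⊗ₖ ρ).submatrix (partySpaceEquiv D own d)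
      (partySpaceEquiv D own d) :=
  rfl

variable [Fintype ι] [DecidableEq ι]

/-- The factor of a product vector that belongs to a party without a share of the resource. -/
def loneVec (D : ι → ℕ) (own : S → ι) (d : S → ℕ) (j : ι) (a : ℕ) :
    Matrix (PartySpace D own d j) Unit ℂ :=
  Matrix.of fun y _ => ket (D j) a y.1

/-- The factor of a product vector that belongs to the parties other than `j`. -/
def restVec (D : ι → ℕ) (own : S → ι) (C : Matrix (∀ s, Fin (d s)) κ ℂ)
    (j : ι) (hj : ∀ s, own s ≠ j) (n : ι → ℕ) :
    Matrix (∀ i : {i // i ≠ j}, PartySpace D own d i) κ ℂ :=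
  Matrix.of fun z k => (∏ i : {i // i ≠ j}, ket (D i) (n i) (z i).1) *
    C (fun s => (z ⟨own s, hj s⟩).2 ⟨s, rfl⟩) k

theorem resourceVec_basisVec_update (own : S → ι) (C : Matrix (∀ s, Fin (d s)) κ ℂ) (j : ι)
    (hj : ∀ s, own s ≠ j) (n : ι → ℕ) (a : ℕ) :
    resourceVec (basisVec D (Function.update n j a)) own C
      = loneTensor j (restVec D own C j hj n) (loneVec D own d j a) := by
  have hrest : ∀ i : {i // i ≠ j}, Function.update n j a i = n i := fun i =>
    Function.update_of_ne i.2 _ _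
  ext x k
  simp only [resourceVec, loneTensor, restVec, loneVec, basisVec, Matrix.of_apply]
  rw [Fintype.prod_eq_mul_prod_subtype_ne _ j, Function.update_self]
  simp only [hrest]
  ring

variable [Fintype S] [DecidableEq S]

theorem IsDensity.jointState {ψ : (∀ j, Fin (D j)) → ℂ} (hψ : IsDensity (pureState ψ))
    (own : S → ι) {ρ : Matrix (∀ s, Fin (d s)) (∀ s, Fin (d s)) ℂ} (hρ : IsDensity ρ) :
    IsDensity (jointState ψ own ρ) := by
  rw [jointState_eq_submatrix]
  have htrace : (pureState ψ ⊗ₖ ρ).trace = 1 := by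
    rw [Matrix.trace_kronecker, hψ.2, hρ.2, one_mul]
  exact ⟨(hψ.1.kronecker hρ.1).submatrix _,
    ((partySpaceEquiv D own d).sum_comp fun y => (pureState ψ ⊗ₖ ρ) y y).trans htrace⟩

open scoped MatrixOrder in
theorem IsDensity.exists_eq_mul_conjTranspose {A : Type} [Fintype A] {ρ : Matrix A A ℂ}
    (hρ : IsDensity ρ) : ∃ C : Matrix A A ℂ, ρ = C * Cᴴ := by
  classical
  obtain ⟨B, hB⟩ := CStarAlgebra.nonneg_iff_eq_star_mul_self.1 hρ.1.nonneg
  exact ⟨Bᴴ, by rwa [Matrix.conjTranspose_conjTranspose]⟩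

theorem norm_resourceVec [Fintype κ] {ψ : (∀ j, Fin (D j)) → ℂ} (hψ : IsDensity (pureState ψ))
    (own : S → ι) {C : Matrix (∀ s, Fin (d s)) κ ℂ} (hC : IsDensity (C * Cᴴ)) :
    ‖resourceVec ψ own C‖ = 1 := by
  rw [← sq_eq_sq₀ (norm_nonneg _) zero_le_one, ← trace_mul_conjTranspose_re,
    ← jointState_mul_conjTranspose, (hψ.jointState own hC).2]
  simp

end Resource

section Payoff

variable {ι S X : Type} [Fintype ι] [DecidableEq ι] [Fintype S] [DecidableEq S] [Fintype X]
  [DecidableEq X] {D : ι → ℕ} {d : S → ℕ} {p : X → ℝ} {ψ : X → (∀ j, Fin (D j)) → ℂ}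
  {own : S → ι} {ρ : Matrix (∀ s, Fin (d s)) (∀ s, Fin (d s)) ℂ}

theorem payoff_lt_sum [Nonempty X] (hp : ∀ x, 0 < p x)
    (hσ : ∀ x, IsDensity (jointState (ψ x) own ρ)) {c : ℝ} (hc : 0 < c)
    (h : ∀ P : LOCC ι X (PartySpace D own d), c ≤ P.error id fun x => jointState (ψ x) own ρ) :
    payoff p ψ own ρ < ∑ x, p x := by
  obtain ⟨x₀, hx₀⟩ := Finite.exists_min p
  have : Nonempty (LOCC ι X (PartySpace D own d)) := ⟨LOCC.guess x₀⟩
  refine lt_of_le_of_lt (ciSup_le fun P => ?_) (sub_lt_self _ (mul_pos (hp x₀) hc))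
  have hle : p x₀ * c ≤ ∑ x, p x * (1 - P.prob (jointState (ψ x) own ρ) x) :=
    calc p x₀ * c ≤ p x₀ * P.error id fun x => jointState (ψ x) own ρ :=
          mul_le_mul_of_nonneg_left (h P) (hp x₀).le
      _ = ∑ x, p x₀ * (1 - P.prob (jointState (ψ x) own ρ) x) := by
          simp only [LOCC.error, (hσ _).2, Complex.one_re, Finset.mul_sum, id]
      _ ≤ _ := Finset.sum_le_sum fun x _ => mul_le_mul_of_nonneg_right (hx₀ x) (sub_nonneg.2 <| by
          simpa only [(hσ x).2, Complex.one_re] using P.prob_le_trace (hσ x).1 x)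
  simp only [mul_sub, mul_one, Finset.sum_sub_distrib] at hle
  linarith

/-- The operators `σ x` are told apart with certainty by some LOCC protocol. -/
def PerfectlyDistinguishable {H : ι → Type} [∀ i, Fintype (H i)] [∀ i, DecidableEq (H i)]
    (σ : X → Matrix (∀ i, H i) (∀ i, H i) ℂ) : Prop :=
  ∃ P : LOCC ι X H, ∀ x, P.prob (σ x) x = (σ x).trace.re

theorem PerfectlyDistinguishable.sum_le_payoff (hp : ∀ x, 0 ≤ p x)
    (hσ : ∀ x, IsDensity (jointState (ψ x) own ρ))
    (h : PerfectlyDistinguishable fun x => jointState (ψ x) own ρ) :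
    ∑ x, p x ≤ payoff p ψ own ρ := by
  obtain ⟨P, hP⟩ := h
  have hbdd : BddAbove (Set.range fun Q : LOCC ι X (PartySpace D own d) =>
      ∑ x, p x * Q.prob (jointState (ψ x) own ρ) x) := by
    refine ⟨∑ x, p x, ?_⟩
    rintro _ ⟨Q, rfl⟩
    refine Finset.sum_le_sum fun x _ => mul_le_of_le_one_right (hp x) ?_
    simpa only [(hσ x).2, Complex.one_re] using Q.prob_le_trace (hσ x).1 x
  refine le_of_eq_of_le ?_ (le_ciSup hbdd P)
  simp only [hP, (hσ _).2, Complex.one_re, mul_one]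

end Payoff

section GStates

theorem prod_eq_pmComb_basisVec {ι : Type} [Fintype ι] {D n n' : ι → ℕ} (j : ι)
    (hn : ∀ k, k ≠ j → n' k = n k) (s : Bool) {φ : ∀ k, Fin (D k) → ℂ}
    (hφj : φ j = ketPM (D j) (n j) (n' j) s) (hφ : ∀ k, k ≠ j → φ k = ket (D k) (n k)) :
    (fun y : (∀ k, Fin (D k)) => ∏ k, φ k (y k)) = pmComb (basisVec D n) (basisVec D n') s := by
  classical
  funext y
  have hrest : ∀ k : {k // k ≠ j}, φ k = ket (D k) (n k) := fun k => hφ k k.2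
  have hrest' : ∀ k : {k // k ≠ j}, n' k = n k := fun k => hn k k.2
  simp only [pmComb, basisVec, Pi.smul_apply, Pi.add_apply, smul_eq_mul]
  simp only [Fintype.prod_eq_mul_prod_subtype_ne _ j, hφj, hrest, hrest', ketPM, boolSign]
  ring

variable {m : ℕ}

/-- The numbers of the basis vectors in the product vector with `|a⟩` for Alice, `|b⟩` for Bob-`i`
and `|k⟩` for every other Bob-`k`. -/
def pairIdx (i : Fin m) (a b : ℕ) : Fin (m + 1) → ℕ :=
  Function.update (Function.update (fun _ => 2) 0 a) i.succ b

@[simp]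
theorem pairIdx_zero (i : Fin m) (a b : ℕ) : pairIdx i a b 0 = a := by
  simp [pairIdx, Function.update_of_ne (Fin.succ_ne_zero i).symm]

@[simp]
theorem pairIdx_succ (i k : Fin m) (a b : ℕ) :
    pairIdx i a b k.succ = if k = i then b else 2 := by
  simp [pairIdx, Function.update_apply]

theorem pairIdx_lt_gDim (i : Fin m) {a b : ℕ} (ha : a < m + 2) (hb : b < 3) (k : Fin (m + 1)) :
    pairIdx i a b k < gDim m k := by
  cases k using Fin.cases with
  | zero => rwa [pairIdx_zero]
  | succ k =>
    rw [pairIdx_succ]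
    change _ < 3
    split_ifs <;> omega

/-- The numbers of the basis vectors in the first of the two product vectors whose sum and
difference are, up to normalization, the states named `l`. -/
def GLabel.fstIdx : GLabel m → Fin (m + 1) → ℕ
  | zero => Function.update (fun _ => 2) 0 0
  | one i => pairIdx i (i + 2) 1
  | two i => pairIdx i 1 0
  | three i => pairIdx i 0 0

/-- The numbers of the basis vectors in the second of these two product vectors. -/
def GLabel.sndIdx : GLabel m → Fin (m + 1) → ℕ
  | zero => Function.update (fun _ => 2) 0 1
  | one i => pairIdx i (i + 2) 2
  | two i => pairIdx i (i + 2) 0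
  | three i => pairIdx i 0 1

/-- The party at which the two product vectors of the states named `l` differ. -/
def GLabel.site : GLabel m → Fin (m + 1)
  | zero => 0
  | one i => i.succ
  | two _ => 0
  | three i => i.succ

theorem GLabel.sndIdx_eq_fstIdx (l : GLabel m) {k : Fin (m + 1)} (hk : k ≠ l.site) :
    l.sndIdx k = l.fstIdx k := by
  cases l <;> cases k using Fin.cases <;>
    simp_all [GLabel.site, GLabel.fstIdx, GLabel.sndIdx]

theorem gLocal_site (l : GLabel m) (s : Bool) :
    gLocal m l s l.site = ketPM (gDim m l.site) (l.fstIdx l.site) (l.sndIdx l.site) s := by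
  cases l <;> simp only [GLabel.site, GLabel.fstIdx, GLabel.sndIdx, Function.update_self,
    pairIdx_zero, pairIdx_succ, if_true]
  case zero => rfl
  case one i => exact if_pos rfl
  case two i => rfl
  case three i => exact if_pos rfl

theorem gLocal_of_ne_site (l : GLabel m) (s : Bool) {k : Fin (m + 1)} (hk : k ≠ l.site) :
    gLocal m l s k = ket (gDim m k) (l.fstIdx k) := by
  cases k using Fin.cases with
  | zero => cases l <;> first | exact absurd rfl hk | (simp only [GLabel.fstIdx, pairIdx_zero]; rfl)
  | succ k =>
    cases l with
    | zero => rfl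
    | one i =>
      have hki : k ≠ i := fun h => hk (congrArg Fin.succ h)
      simp only [GLabel.fstIdx, pairIdx_succ, if_neg hki]
      exact if_neg hki
    | two i =>
      simp only [GLabel.fstIdx, pairIdx_succ]
      exact (apply_ite (ket 3) _ _ _).symm
    | three i =>
      have hki : k ≠ i := fun h => hk (congrArg Fin.succ h)
      simp only [GLabel.fstIdx, pairIdx_succ, if_neg hki]
      exact if_neg hki

theorem gState_eq_pmComb (l : GLabel m) (s : Bool) :
    gState m (l, s) = pmComb (basisVec (gDim m) l.fstIdx) (basisVec (gDim m) l.sndIdx) s :=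
  prod_eq_pmComb_basisVec l.site (fun _ => l.sndIdx_eq_fstIdx) s (gLocal_site l s)
    fun _ => gLocal_of_ne_site l s

theorem GLabel.fstIdx_lt_gDim (l : GLabel m) (k : Fin (m + 1)) : l.fstIdx k < gDim m k := by
  cases l with
  | zero => cases k using Fin.cases <;> simp [GLabel.fstIdx, gDim]
  | one i => exact pairIdx_lt_gDim i (by omega) (by omega) k
  | two i => exact pairIdx_lt_gDim i (by omega) (by omega) k
  | three i => exact pairIdx_lt_gDim i (by omega) (by omega) k

theorem GLabel.sndIdx_lt_gDim (l : GLabel m) (k : Fin (m + 1)) : l.sndIdx k < gDim m k := by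
  cases l with
  | zero => cases k using Fin.cases <;> simp [GLabel.sndIdx, gDim]
  | one i => exact pairIdx_lt_gDim i (by omega) (by omega) k
  | two i => exact pairIdx_lt_gDim i (by omega) (by omega) k
  | three i => exact pairIdx_lt_gDim i (by omega) (by omega) k

theorem GLabel.fstIdx_ne_sndIdx (l : GLabel m) : l.fstIdx ≠ l.sndIdx := fun h => by
  have := congrFun h l.site
  cases l <;> simp [GLabel.site, GLabel.fstIdx, GLabel.sndIdx] at this

theorem isDensity_pureState_gState (x : GLabel m × Bool) : IsDensity (pureState (gState m x)) := by
  rw [← Prod.mk.eta (p := x), gState_eq_pmComb]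
  exact isDensity_pureState_pmComb_basisVec (GLabel.fstIdx_lt_gDim _) (GLabel.sndIdx_lt_gDim _)
    (GLabel.fstIdx_ne_sndIdx _) _

end GStates

section LowerBound

open scoped Matrix.Norms.Frobenius

variable {m : ℕ} {S κ : Type} {d : S → ℕ}

/-- The grid `T w.rev u` is `T` turned by a right angle, which permutes the tiles. -/
theorem gramOp_domino_rotate {A : Type} [Fintype κ] (T : Fin 3 → Fin 3 → Matrix A κ ℂ)
    (q : Fin 4 × Bool) :
    gramOp (domino fun u w => T w.rev u) q = gramOp (domino T) (q.1 - 1, q.2) := by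
  have hswap : ∀ F G : Matrix A κ ℂ, pmComb F G q.2 * (pmComb F G q.2)ᴴ
      = pmComb G F q.2 * (pmComb G F q.2)ᴴ := fun F G => by
    rw [pmComb_swap, Matrix.conjTranspose_smul, Matrix.smul_mul, Matrix.mul_smul, smul_smul]
    cases q.2 <;> simp [boolSign]
  obtain ⟨l, s⟩ := q
  fin_cases l
  · rfl
  · exact hswap _ _
  · rfl
  · exact hswap _ _

/-- The numbers of the basis vectors in the cell `(u, w)` of the domino pattern formed by Alice
(rows `|p⟩, |q⟩, |i⟩`) and Bob-`i` (columns `|p⟩, |q⟩, |i⟩`). -/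
def gridIdx (i : Fin m) (u w : Fin 3) : Fin (m + 1) → ℕ :=
  pairIdx i (![0, 1, i.val + 2] u) w.val

/-- The names of the states that form the domino pattern of Alice and Bob-`i`. -/
def tileLabel (i : Fin m) : Fin 4 → GLabel m :=
  ![.zero, .one i, .two i, .three i]

theorem tileLabel_injective (i : Fin m) : Function.Injective (tileLabel i) := by
  intro l l' h
  fin_cases l <;> fin_cases l' <;> simp_all [tileLabel]

theorem resourceVec_gState_tileLabel (i : Fin m) (own : S → Fin (m + 1))
    (C : Matrix (∀ s, Fin (d s)) κ ℂ) (q : Fin 4 × Bool) :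
    resourceVec (gState m (tileLabel i q.1, q.2)) own C
      = domino (fun u w => resourceVec (basisVec (gDim m) (gridIdx i u w)) own C) q := by
  have hfst : (tileLabel i q.1).fstIdx = gridIdx i (dominoFst q.1).1 (dominoFst q.1).2 := by
    obtain ⟨l, s⟩ := q
    fin_cases l <;> simp [tileLabel, gridIdx, pairIdx, dominoFst, GLabel.fstIdx]
  have hsnd : (tileLabel i q.1).sndIdx = gridIdx i (dominoSnd q.1).1 (dominoSnd q.1).2 := by
    obtain ⟨l, s⟩ := q
    fin_cases l <;> simp [tileLabel, gridIdx, pairIdx, dominoSnd, GLabel.sndIdx]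
  rw [gState_eq_pmComb, resourceVec_pmComb, hfst, hsnd, domino]

theorem gridIdx_lt_gDim (i : Fin m) (u w : Fin 3) (k : Fin (m + 1)) :
    gridIdx i u w k < gDim m k := by
  refine pairIdx_lt_gDim i ?_ w.isLt k
  fin_cases u <;> simp

variable [Fintype S] [DecidableEq S] [Fintype κ]

theorem norm_resourceVec_gridIdx (i : Fin m) (u w : Fin 3) (own : S → Fin (m + 1))
    {C : Matrix (∀ s, Fin (d s)) κ ℂ} (hC : IsDensity (C * Cᴴ)) :
    ‖resourceVec (basisVec (gDim m) (gridIdx i u w)) own C‖ = 1 :=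
  norm_resourceVec (isDensity_pureState_basisVec (gridIdx_lt_gDim i u w)) own hC

theorem le_error_of_norm_eq_one {ι X : Type} [Fintype ι] [DecidableEq ι] [DecidableEq X]
    {H : ι → Type} [∀ i, Fintype (H i)] [∀ i, DecidableEq (H i)] {lab : Fin 4 × Bool → X}
    (hlab : Function.Injective lab) (P : LOCC ι X H) (j : ι)
    {V : Fin 3 → Matrix (∀ i : {i // i ≠ j}, H i) κ ℂ} {β : Fin 3 → Matrix (H j) Unit ℂ}
    (h : ∀ u w, ‖loneTensor j (V u) (β w)‖ = 1) :
    9 / 546 ≤ P.error lab (gramOp (domino fun u w => loneTensor j (V u) (β w))) :=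
  (le_dominoPotential_of_mul_eq_one (fun _ => norm_nonneg _) (fun _ => norm_nonneg _)
    fun u w => by rw [← norm_loneTensor, h]).trans (dominoPotential_le_error hlab P j V β)

variable {own : S → Fin (m + 1)} {C : Matrix (∀ s, Fin (d s)) κ ℂ}

theorem le_error_of_succ_not_own (hC : IsDensity (C * Cᴴ)) (i : Fin m)
    (hi : ∀ s, own s ≠ i.succ) {X : Type} [DecidableEq X] {lab : Fin 4 × Bool → X}
    (hlab : Function.Injective lab) (P : LOCC (Fin (m + 1)) X (PartySpace (gDim m) own d)) :
    9 / 546 ≤ P.error lab (gramOp (domino fun u w =>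
      resourceVec (basisVec (gDim m) (gridIdx i u w)) own C)) := by
  have hT : ∀ u w, resourceVec (basisVec (gDim m) (gridIdx i u w)) own C =
      loneTensor i.succ
        (restVec (gDim m) own C i.succ hi (Function.update (fun _ => 2) 0 (![0, 1, i.val + 2] u)))
        (loneVec (gDim m) own d i.succ w) :=
    fun u w => resourceVec_basisVec_update own C i.succ hi _ _
  simp only [hT]
  exact le_error_of_norm_eq_one hlab P _ fun u w => by
    rw [← hT, norm_resourceVec_gridIdx i u w own hC]

theorem le_error_of_zero_not_own (hC : IsDensity (C * Cᴴ)) (i : Fin m)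
    (h0 : ∀ s, own s ≠ 0) {X : Type} [DecidableEq X] {lab : Fin 4 × Bool → X}
    (hlab : Function.Injective lab) (P : LOCC (Fin (m + 1)) X (PartySpace (gDim m) own d)) :
    9 / 546 ≤ P.error lab (gramOp (domino fun u w =>
      resourceVec (basisVec (gDim m) (gridIdx i u w)) own C)) := by
  have hT : ∀ u w, resourceVec (basisVec (gDim m) (gridIdx i u w)) own C =
      loneTensor 0
        (restVec (gDim m) own C 0 h0 (Function.update (fun _ => 2) i.succ w.val))
        (loneVec (gDim m) own d 0 (![0, 1, i.val + 2] u)) := fun u w => by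
    rw [← resourceVec_basisVec_update, gridIdx, pairIdx,
      Function.update_comm (Fin.succ_ne_zero i).symm]
  have hrot : Function.Injective fun q : Fin 4 × Bool => (q.1 - 1, q.2) :=
    (sub_left_injective (b := (1 : Fin 4))).prodMap Function.injective_id
  refine le_trans ?_ (P.error_comp_le hrot lab fun q => Matrix.posSemidef_self_mul_conjTranspose _)
  simp only [Function.comp_def, ← gramOp_domino_rotate, hT]
  exact le_error_of_norm_eq_one (hlab.comp hrot) P _ fun u w => by
    rw [← hT, norm_resourceVec_gridIdx i _ _ own hC]

theorem le_error_gState (hm : 1 ≤ m) {ρ : Matrix (∀ s, Fin (d s)) (∀ s, Fin (d s)) ℂ}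
    (hρ : IsDensity ρ) (hown : ¬ Function.Surjective own)
    (P : LOCC (Fin (m + 1)) (GLabel m × Bool) (PartySpace (gDim m) own d)) :
    9 / 546 ≤ P.error id fun x => jointState (gState m x) own ρ := by
  obtain ⟨C, rfl⟩ := hρ.exists_eq_mul_conjTranspose
  have htiles : ∀ i, P.error (Prod.map (tileLabel i) id) (gramOp (domino fun u w =>
      resourceVec (basisVec (gDim m) (gridIdx i u w)) own C)) ≤
      P.error id fun x => jointState (gState m x) own (C * Cᴴ) := fun i => by
    refine le_of_eq_of_le (congrArg _ (funext fun q => ?_)) (P.error_comp_le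
      ((tileLabel_injective i).prodMap Function.injective_id) id
      fun x => ((isDensity_pureState_gState x).jointState own hρ).1)
    rw [Function.comp_apply, jointState_mul_conjTranspose, gramOp, ← resourceVec_gState_tileLabel]
    rfl
  have hlab : ∀ i : Fin m, Function.Injective (Prod.map (tileLabel i) (id : Bool → Bool)) :=
    fun i => (tileLabel_injective i).prodMap Function.injective_id
  simp only [Function.Surjective, not_forall, not_exists] at hown
  obtain ⟨j, hj⟩ := hown
  cases j using Fin.cases with
  | zero => exact (le_error_of_zero_not_own hρ ⟨0, hm⟩ hj (hlab _) P).trans (htiles _)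
  | succ i => exact (le_error_of_succ_not_own hρ i hj (hlab _) P).trans (htiles _)

end LowerBound

section PerfectDiscrimination

theorem trace_submatrix_equiv {A B : Type} [Fintype A] [Fintype B] (M : Matrix A A ℂ)
    (e : B ≃ A) : (M.submatrix e e).trace = M.trace :=
  e.sum_comp fun a => M a a

variable {ι X : Type} [Fintype ι] [DecidableEq ι] [DecidableEq X] {H H' : ι → Type}
  [∀ i, Fintype (H i)]

theorem tensorOp_mul_pureState_mul_conjTranspose (K : ∀ i, Matrix (H' i) (H i) ℂ)
    (v : (∀ i, H i) → ℂ) :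
    tensorOp K * pureState v * (tensorOp K)ᴴ = pureState (tensorOp K *ᵥ v) := by
  rw [pureState, Matrix.mul_vecMulVec, Matrix.vecMulVec_mul, ← Matrix.star_mulVec, pureState]

variable [∀ i, DecidableEq (H i)]

theorem PerfectlyDistinguishable.of_eq_zero {σ : X → Matrix (∀ i, H i) (∀ i, H i) ℂ} (x₀ : X)
    (h : ∀ x, x ≠ x₀ → σ x = 0) : PerfectlyDistinguishable σ := by
  refine ⟨LOCC.guess x₀, fun x => ?_⟩
  rw [LOCC.prob]
  split_ifs with hx
  · rfl
  · rw [h x (Ne.symm hx), Matrix.trace_zero, Complex.zero_re]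

variable [∀ i, Fintype (H' i)] [∀ i, DecidableEq (H' i)]

theorem PerfectlyDistinguishable.submatrix_equiv {σ : X → Matrix (∀ i, H i) (∀ i, H i) ℂ}
    (hσ : PerfectlyDistinguishable σ) (e : ∀ i, H' i ≃ H i) :
    PerfectlyDistinguishable fun x =>
      (σ x).submatrix (Equiv.piCongrRight e) (Equiv.piCongrRight e) := by
  obtain ⟨P, hP⟩ := hσ
  cases P with
  | guess y =>
    refine ⟨LOCC.guess y, fun x => ?_⟩
    rw [trace_submatrix_equiv, ← hP, LOCC.prob, LOCC.prob, trace_submatrix_equiv]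
  | round k d K hK next =>
    refine ⟨LOCC.round k d (fun i a => (K i a).submatrix id (e i)) (fun i => ?_) next,
      fun x => ?_⟩
    · rw [← Matrix.submatrix_one_equiv (e i), ← hK i]
      ext y z
      simp only [Matrix.sum_apply, Matrix.submatrix_apply, Matrix.mul_apply,
        Matrix.conjTranspose_apply, id]
    · rw [trace_submatrix_equiv, ← hP, LOCC.prob, LOCC.prob]
      refine Finset.sum_congr rfl fun a _ => congrArg (fun τ => (next a).prob τ x) ?_
      have htensor : tensorOp (fun i => (K i (a i)).submatrix id (e i)) =
          (tensorOp fun i => K i (a i)).submatrix id (Equiv.piCongrRight e) := rfl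
      rw [htensor, Matrix.conjTranspose_submatrix, Matrix.submatrix_mul_equiv,
        Matrix.submatrix_mul_equiv, Matrix.submatrix_id_id]

theorem PerfectlyDistinguishable.of_round {O : ι → Type} [∀ i, Fintype (O i)]
    (K : ∀ i, O i → Matrix (H' i) (H i) ℂ) (hK : ∀ i, ∑ a, (K i a)ᴴ * K i a = 1)
    {σ : X → Matrix (∀ i, H i) (∀ i, H i) ℂ}
    (h : ∀ a : (∀ i, O i), PerfectlyDistinguishable fun x =>
      tensorOp (fun i => K i (a i)) * σ x * (tensorOp fun i => K i (a i))ᴴ) :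
    PerfectlyDistinguishable σ := by
  let eO := fun i => Fintype.equivFin (O i)
  let eH := fun i => Fintype.equivFin (H' i)
  choose next hnext using fun a : (∀ i, Fin (Fintype.card (O i))) =>
    (h fun i => (eO i).symm (a i)).submatrix_equiv fun i => (eH i).symm
  refine ⟨LOCC.round _ _ (fun i a => (K i ((eO i).symm a)).submatrix (eH i).symm id)
    (fun i => ?_) next, fun x => ?_⟩
  · simp only [Matrix.conjTranspose_submatrix, Matrix.submatrix_mul_equiv, Matrix.submatrix_id_id]
    rw [← hK i]
    exact (eO i).symm.sum_comp fun a => (K i a)ᴴ * K i a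
  · rw [LOCC.prob, ← sum_trace_mul_mul_conjTranspose _
      (sum_conjTranspose_tensorOp_mul_tensorOp K hK), Complex.re_sum,
      ← (Equiv.piCongrRight fun i => (eO i).symm).sum_comp]
    refine Finset.sum_congr rfl fun a _ => ?_
    have htensor : tensorOp (fun i => (K i ((eO i).symm (a i))).submatrix (eH i).symm id) =
        (tensorOp fun i => K i ((eO i).symm (a i))).submatrix
          (Equiv.piCongrRight fun i => (eH i).symm) id := rfl
    rw [htensor, Matrix.conjTranspose_submatrix]
    refine (hnext a x).trans (congrArg Complex.re ?_)
    exact trace_submatrix_equiv _ _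

theorem PerfectlyDistinguishable.of_measure {O : ι → Type} (g : ∀ i, H i → O i)
    {v : X → (∀ i, H i) → ℂ}
    (h : ∀ a : (∀ i, O i), PerfectlyDistinguishable fun x =>
      pureState ({y | ∀ i, g i (y i) = a i}.indicator (v x))) :
    PerfectlyDistinguishable fun x => pureState (v x) := by
  classical
  refine .of_round (O := fun i => Set.range (g i))
    (fun i a => Matrix.diagonal fun y => if g i y = a then 1 else 0) (fun i => ?_) fun a => ?_
  · simp only [Matrix.diagonal_conjTranspose, Matrix.diagonal_mul_diagonal]
    refine (map_sum (Matrix.diagonalAddMonoidHom (H i) ℂ) _ _).symm.trans ?_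
    refine (congrArg _ (funext fun y => ?_)).trans Matrix.diagonal_one
    rw [Finset.sum_apply, Finset.sum_eq_single ⟨g i y, y, rfl⟩ (fun a _ ha => ?_) (by simp)]
    · simp
    · simp [show g i y ≠ a from fun h => ha (Subtype.ext h.symm)]
  · convert h (fun i => a i) using 2 with x
    rw [tensorOp_mul_pureState_mul_conjTranspose, tensorOp_diagonal]
    congr 1
    funext y
    rw [Matrix.mulVec_diagonal, Finset.prod_ite_zero]
    simp [Set.indicator_apply]

section Involution

variable {A : Type} [DecidableEq A] {U : Matrix A A ℂ}

/-- The projection onto the eigenspace of the involution `U` with the eigenvalue `boolSign s`. -/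
noncomputable def signProj (U : Matrix A A ℂ) (s : Bool) : Matrix A A ℂ :=
  (2⁻¹ : ℂ) • (1 + boolSign s • U)

theorem conjTranspose_signProj (hU : Uᴴ = U) (s : Bool) : (signProj U s)ᴴ = signProj U s := by
  cases s <;> simp [signProj, boolSign, hU]

variable [Fintype A]

theorem signProj_mul (hU : U * U = 1) (s : Bool) :
    signProj U s * U = boolSign s • signProj U s := by
  rw [signProj, Matrix.smul_mul, smul_comm (boolSign s)]
  congr 1
  rw [Matrix.add_mul, Matrix.one_mul, Matrix.smul_mul, hU, smul_add, smul_smul, boolSign_mul_self,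
    one_smul, add_comm]

theorem signProj_mul_self (hU : U * U = 1) (s : Bool) :
    signProj U s * signProj U s = signProj U s := by
  nth_rw 2 [signProj]
  rw [Matrix.mul_smul, Matrix.mul_add, Matrix.mul_one, Matrix.mul_smul, signProj_mul hU, smul_smul,
    boolSign_mul_self]
  module

theorem sum_conjTranspose_signProj_mul_signProj (hU : Uᴴ = U) (hUU : U * U = 1) :
    ∑ s, (signProj U s)ᴴ * signProj U s = 1 := by
  simp only [conjTranspose_signProj hU, signProj_mul_self hUU, Fintype.sum_bool]
  simp only [signProj, boolSign, if_true, Bool.false_eq_true, if_false]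
  module

end Involution

theorem PerfectlyDistinguishable.of_involution (U : ∀ i, Matrix (H i) (H i) ℂ)
    (hU : ∀ i, (U i)ᴴ = U i) (hUU : ∀ i, U i * U i = 1)
    {σ : X → Matrix (∀ i, H i) (∀ i, H i) ℂ} (x : Bool → X)
    (hx : ∀ y, (∀ s, y ≠ x s) → σ y = 0)
    (hσ : ∀ s, tensorOp U * σ (x s) = boolSign s • σ (x s)) : PerfectlyDistinguishable σ := by
  refine .of_round (O := fun _ => Bool) (fun i => signProj (U i))
    (fun i => sum_conjTranspose_signProj_mul_signProj (hU i) (hUU i)) fun a => ?_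
  obtain ⟨t, ht⟩ := exists_boolSign_eq_prod a
  have hcomm : ∀ s, boolSign t • (tensorOp (fun i => signProj (U i) (a i)) * σ (x s)) =
      boolSign s • (tensorOp (fun i => signProj (U i) (a i)) * σ (x s)) := fun s => by
    rw [← Matrix.mul_smul _ (boolSign s), ← hσ, ← Matrix.mul_assoc, tensorOp_mul]
    simp only [signProj_mul (hUU _)]
    rw [tensorOp_smul, ← ht, Matrix.smul_mul]
  refine .of_eq_zero (x t) fun y hy => ?_
  suffices tensorOp (fun i => signProj (U i) (a i)) * σ y = 0 by rw [this, Matrix.zero_mul]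
  by_cases hyx : ∃ s, y = x s
  · obtain ⟨s, rfl⟩ := hyx
    have hst : boolSign t - boolSign s ≠ 0 := by
      have : s ≠ t := fun h => hy (congrArg x h)
      cases s <;> cases t <;> first | exact absurd rfl this | norm_num [boolSign]
    have hzero := sub_eq_zero.2 (hcomm s)
    rw [← sub_smul] at hzero
    exact (smul_eq_zero.1 hzero).resolve_left hst
  · rw [hx y fun s hs => hyx ⟨s, hs⟩, Matrix.mul_zero]

theorem PerfectlyDistinguishable.of_involutive_perm (τ : ∀ i, Equiv.Perm (H i))
    (hτ : ∀ i, τ i * τ i = 1) {v : X → (∀ i, H i) → ℂ} (x : Bool → X)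
    (hx : ∀ y, (∀ s, y ≠ x s) → v y = 0)
    (hv : ∀ s y, v (x s) (fun i => τ i (y i)) = boolSign s * v (x s) y) :
    PerfectlyDistinguishable fun y => pureState (v y) := by
  refine .of_involution (fun i => (τ i).permMatrix ℂ) (fun i => ?_) (fun i => ?_) x
    (fun y hy => ?_) fun s => ?_
  · rw [Matrix.conjTranspose_permMatrix, inv_eq_of_mul_eq_one_left (hτ i)]
  · rw [← Matrix.permMatrix_mul, hτ, Matrix.permMatrix_one]
  · rw [hx y hy, pureState, Matrix.zero_vecMulVec]
  · have hperm : Equiv.Perm.permMatrix ℂ (Equiv.piCongrRight τ) *ᵥ v (x s) =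
        boolSign s • v (x s) := by
      rw [Matrix.permMatrix_mulVec]
      exact funext (hv s)
    rw [tensorOp_permMatrix, pureState, Matrix.mul_vecMulVec, hperm, Matrix.smul_vecMulVec]

end PerfectDiscrimination

section GHZ

theorem ghz_eq_pmComb (n : ℕ) :
    ghz n = pmComb (basisVec (fun _ => 2) fun _ => 0) (basisVec (fun _ => 2) fun _ => 1) true := by
  funext y
  simp only [ghz, Fin.ext_iff, Fin.val_zero, Fin.val_one, pmComb, basisVec_apply, boolSign, if_true,
    one_smul, Pi.smul_apply, Pi.add_apply, smul_eq_mul]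
  congr!

theorem isDensity_pureState_ghz (m : ℕ) : IsDensity (pureState (ghz (m + 1))) := by
  rw [ghz_eq_pmComb]
  exact isDensity_pureState_pmComb_basisVec (fun _ => zero_lt_two) (fun _ => one_lt_two)
    (fun h => zero_ne_one (congrFun h 0)) true

theorem ghz_comp_perm {n : ℕ} (τ : Equiv.Perm (Fin 2)) (y : Fin n → Fin 2) :
    ghz n (fun j => τ (y j)) = ghz n y := by
  obtain rfl | rfl : τ = 1 ∨ τ = Equiv.swap 0 1 := by
    revert τ
    decide
  · rfl
  · simp only [ghz, Equiv.swap_apply_eq_iff, Equiv.swap_apply_left, Equiv.swap_apply_right]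
    rw [add_comm]

theorem exists_forall_eq_of_ghz_ne_zero {n : ℕ} {y : Fin n → Fin 2} (h : ghz n y ≠ 0) :
    ∃ t, ∀ j, y j = t := by
  by_contra hy
  rw [not_exists] at hy
  simp [ghz, hy] at h

theorem basisVec_swap {ι : Type} [Fintype ι] {D n n' : ι → ℕ} (hn : ∀ k, n k < D k)
    (hn' : ∀ k, n' k < D k) (y : ∀ k, Fin (D k)) :
    basisVec D n (fun k => Equiv.swap ⟨n k, hn k⟩ ⟨n' k, hn' k⟩ (y k)) = basisVec D n' y := by
  have hswap : ∀ k, (Equiv.swap ⟨n k, hn k⟩ ⟨n' k, hn' k⟩ (y k)).val = n k ↔ (y k).val = n' k :=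
    fun k => by
      have h := Equiv.swap_apply_eq_iff (x := ⟨n k, hn k⟩) (y := ⟨n' k, hn' k⟩) (z := y k)
        (w := ⟨n k, hn k⟩)
      rwa [Equiv.swap_apply_left, Fin.ext_iff, Fin.ext_iff] at h
  simp only [basisVec_apply, hswap]

variable {m : ℕ}

theorem gState_swap (l : GLabel m) (s : Bool) (y : ∀ k, Fin (gDim m k)) :
    gState m (l, s) (fun k => Equiv.swap ⟨l.fstIdx k, l.fstIdx_lt_gDim k⟩
      ⟨l.sndIdx k, l.sndIdx_lt_gDim k⟩ (y k)) = boolSign s * gState m (l, s) y := by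
  have hfst := basisVec_swap l.fstIdx_lt_gDim l.sndIdx_lt_gDim y
  have hsnd := basisVec_swap l.sndIdx_lt_gDim l.fstIdx_lt_gDim y
  simp only [Equiv.swap_comm (⟨l.sndIdx _, _⟩ : Fin _)] at hsnd
  rw [gState_eq_pmComb, ← smul_eq_mul, ← Pi.smul_apply, ← pmComb_swap]
  simp only [pmComb, Pi.smul_apply, Pi.add_apply, hfst, hsnd]

theorem forall_val_eq_or_of_gState_ne_zero {l : GLabel m} {s : Bool} {y : ∀ k, Fin (gDim m k)}
    (h : gState m (l, s) y ≠ 0) :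
    (∀ k, (y k).val = l.fstIdx k) ∨ ∀ k, (y k).val = l.sndIdx k := by
  by_contra hy
  rw [not_or] at hy
  simp [gState_eq_pmComb, pmComb, basisVec_apply, hy] at h

/-- The basis of the space of the party `k`: its share of the state to be identified and one
qubit. -/
abbrev GhzSpace (m : ℕ) (k : Fin (m + 1)) : Type :=
  PartySpace (gDim m) (id : Fin (m + 1) → Fin (m + 1)) (fun _ => 2) k

/-- The product of a state of the set with the GHZ state, arranged party by party. -/
noncomputable def ghzAssistedState (x : GLabel m × Bool) : (∀ k, GhzSpace m k) → ℂ := fun y =>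
  gState m x (fun k => (y k).1) * ghz (m + 1) fun k => (y k).2 ⟨k, rfl⟩

/-- The product basis vectors which occur in the states named `l`, together with those of the GHZ
state. -/
def GLabel.InSupport (l : GLabel m) (y : ∀ k, GhzSpace m k) : Prop :=
  ((∀ k, (y k).1.val = l.fstIdx k) ∨ ∀ k, (y k).1.val = l.sndIdx k) ∧
    ∃ t, ∀ k, (y k).2 ⟨k, rfl⟩ = t

theorem inSupport_of_ghzAssistedState_ne_zero {l : GLabel m} {s : Bool} {y : ∀ k, GhzSpace m k}
    (h : ghzAssistedState (l, s) y ≠ 0) : l.InSupport y :=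
  ⟨forall_val_eq_or_of_gState_ne_zero (left_ne_zero_of_mul h),
    exists_forall_eq_of_ghz_ne_zero (right_ne_zero_of_mul h)⟩

/-- The permutation of the basis of each qubit that accompanies the exchange of the two product
vectors of the states named `l`. It is a flip for the states `(i,2)`, whose two product vectors lie
on different sides of Alice's comparison of her share with her qubit. -/
def GLabel.qubitPerm : GLabel m → Equiv.Perm (Fin 2)
  | two _ => Equiv.swap 0 1
  | _ => 1

/-- The local permutations which exchange the two product vectors of the states named `l`. -/
def GLabel.exchange (l : GLabel m) (k : Fin (m + 1)) : Equiv.Perm (GhzSpace m k) :=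
  Equiv.prodCongr (Equiv.swap ⟨l.fstIdx k, l.fstIdx_lt_gDim k⟩ ⟨l.sndIdx k, l.sndIdx_lt_gDim k⟩)
    (Equiv.piCongrRight fun _ => l.qubitPerm)

theorem GLabel.exchange_mul_self (l : GLabel m) (k : Fin (m + 1)) :
    l.exchange k * l.exchange k = 1 := by
  have h : ∀ t, l.qubitPerm (l.qubitPerm t) = t := by
    cases l <;> simp [qubitPerm]
  exact Equiv.ext fun y => Prod.ext (Equiv.swap_apply_self _ _ _) (funext fun _ => h _)

theorem ghzAssistedState_exchange (l : GLabel m) (s : Bool) (y : ∀ k, GhzSpace m k) :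
    ghzAssistedState (l, s) (fun k => l.exchange k (y k)) =
      boolSign s * ghzAssistedState (l, s) y := by
  rw [ghzAssistedState, ghzAssistedState, ← mul_assoc, ← gState_swap,
    ← ghz_comp_perm l.qubitPerm fun k => (y k).2 ⟨k, rfl⟩]
  rfl

end GHZ

section Protocol

variable {m : ℕ}

/-- Alice's measurement in the first round: she compares whether her share lies outside the span of
`|p⟩` and `|q⟩` with the value of her qubit. -/
def aliceComparison (k : Fin (m + 1)) (z : GhzSpace m k) : Prop :=
  k = 0 ∧ (z.1.val ≤ 1 ↔ z.2 ⟨k, rfl⟩ = 1)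

/-- Bob-`i`'s measurement in the second round, given the outcome `o` of the first: he finds out
whether the state is named `(i,2)` or `(i,3)`. -/
def bobTest (o : Prop) (k : Fin (m + 1)) (z : GhzSpace m k) : Prop :=
  k ≠ 0 ∧ (z.1.val = 0 ∨ z.1.val = 1 ∧ (z.2 ⟨k, rfl⟩ = 1 ↔ o))

open Classical in
/-- Alice's measurement in the third round, given the outcomes `r` of the second: she finds out the
rest of the name. -/
noncomputable def aliceTest (r : Fin (m + 1) → Prop) (k : Fin (m + 1)) (z : GhzSpace m k) : ℕ :=
  if k = 0 then if ∃ i, r i then min z.1.val 1 else max z.1.val 1 else 0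

/-- The outcomes of the second round for the states named `l`. -/
def GLabel.bobOutcome : GLabel m → Fin (m + 1) → Prop
  | zero => fun _ => False
  | one _ => fun _ => False
  | two i => fun k => k = i.succ
  | three i => fun k => k = i.succ

/-- Alice's outcome in the third round for the states named `l`. -/
def GLabel.aliceOutcome : GLabel m → ℕ
  | zero => 1
  | one i => i + 2
  | two _ => 1
  | three _ => 0

theorem GLabel.eq_of_outcomes_eq {l l' : GLabel m} (h : l.bobOutcome = l'.bobOutcome)
    (h' : l.aliceOutcome = l'.aliceOutcome) : l = l' := by
  have hmp : ∀ i : Fin m, l.bobOutcome i.succ → l'.bobOutcome i.succ := fun i =>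
    (congrFun h i.succ).mp
  have hmpr : ∀ i : Fin m, l'.bobOutcome i.succ → l.bobOutcome i.succ := fun i =>
    (congrFun h i.succ).mpr
  clear h
  cases l <;> cases l' <;> simp_all [GLabel.bobOutcome, GLabel.aliceOutcome, Fin.val_inj]

theorem GLabel.InSupport.aliceComparison_exchange {l : GLabel m} {y : ∀ k, GhzSpace m k}
    (h : l.InSupport y) (k : Fin (m + 1)) :
    aliceComparison k (l.exchange k (y k)) = aliceComparison k (y k) := by
  by_cases hk : k = 0
  · subst hk
    have hexch : l.exchange 0 (y 0) = (Equiv.swap ⟨l.fstIdx 0, l.fstIdx_lt_gDim 0⟩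
      ⟨l.sndIdx 0, l.sndIdx_lt_gDim 0⟩ (y 0).1, fun s => l.qubitPerm ((y 0).2 s)) := rfl
    have hval : (y 0).1 = ⟨l.fstIdx 0, l.fstIdx_lt_gDim 0⟩ ∨
        (y 0).1 = ⟨l.sndIdx 0, l.sndIdx_lt_gDim 0⟩ :=
      h.1.imp (fun h => Fin.ext (h 0)) fun h => Fin.ext (h 0)
    have hflip : ∀ t : Fin 2, Equiv.swap 0 1 t = 1 ↔ t ≠ 1 := by decide
    rcases hval with hval | hval <;> simp only [aliceComparison, hexch, hval, Equiv.swap_apply_left,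
      Equiv.swap_apply_right] <;> cases l <;>
      simp [GLabel.qubitPerm, GLabel.fstIdx, GLabel.sndIdx, hflip]
  · simp only [aliceComparison, hk, false_and]

theorem GLabel.InSupport.bobTest_eq {l : GLabel m} {y : ∀ k, GhzSpace m k} (h : l.InSupport y)
    (k : Fin (m + 1)) : bobTest (aliceComparison 0 (y 0)) k (y k) = l.bobOutcome k := by
  obtain ⟨h1, t, ht⟩ := h
  have ho : ((y k).2 ⟨k, rfl⟩ = 1 ↔ aliceComparison 0 (y 0)) ↔ (y 0).1.val ≤ 1 := by
    rw [ht k, aliceComparison, ht 0]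
    tauto
  simp only [bobTest, ho, eq_iff_iff]
  cases k using Fin.cases with
  | zero => cases l <;> simp [GLabel.bobOutcome, (Fin.succ_ne_zero _).symm]
  | succ k =>
    rcases h1 with h1 | h1 <;> simp only [h1] <;> cases l <;>
      simp [GLabel.bobOutcome, GLabel.fstIdx, GLabel.sndIdx] <;>
      split_ifs <;> simp_all

theorem GLabel.InSupport.aliceTest_eq {l : GLabel m} {y : ∀ k, GhzSpace m k} (h : l.InSupport y)
    (k : Fin (m + 1)) :
    aliceTest l.bobOutcome k (y k) = if k = 0 then l.aliceOutcome else 0 := by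
  by_cases hk : k = 0
  · subst hk
    rcases h.1 with h1 | h1 <;> simp only [aliceTest, h1, if_true] <;> cases l <;>
      simp [GLabel.bobOutcome, GLabel.aliceOutcome, GLabel.fstIdx, GLabel.sndIdx]
  · simp only [aliceTest, if_neg hk]

/-- The product basis vectors that are compatible with the outcomes `o`, `r` and `b` of the three
rounds. -/
def outcomeSet (o r : Fin (m + 1) → Prop) (b : Fin (m + 1) → ℕ) : Set (∀ k, GhzSpace m k) :=
  {y | ∀ k, aliceTest r k (y k) = b k} ∩ ({y | ∀ k, bobTest (o 0) k (y k) = r k} ∩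
    {y | ∀ k, aliceComparison k (y k) = o k})

theorem GLabel.InSupport.mem_outcomeSet_iff {l : GLabel m} {y : ∀ k, GhzSpace m k}
    (h : l.InSupport y) {o r : Fin (m + 1) → Prop} {b : Fin (m + 1) → ℕ} :
    y ∈ outcomeSet o r b ↔ (∀ k, aliceComparison k (y k) = o k) ∧ l.bobOutcome = r ∧
      ∀ k, (if k = 0 then l.aliceOutcome else 0) = b k := by
  have hbob : (∀ k, aliceComparison k (y k) = o k) →
      ((∀ k, bobTest (o 0) k (y k) = r k) ↔ l.bobOutcome = r) := fun ho => by
    simp only [← ho 0, h.bobTest_eq, funext_iff]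
  have halice : l.bobOutcome = r → ((∀ k, aliceTest r k (y k) = b k) ↔
      ∀ k, (if k = 0 then l.aliceOutcome else 0) = b k) := fun hr => by
    simp only [← hr, h.aliceTest_eq]
  simp only [outcomeSet, Set.mem_inter_iff, Set.mem_ofPred_eq]
  tauto

theorem indicator_ghzAssistedState_exchange (l : GLabel m) (s : Bool) (o r : Fin (m + 1) → Prop)
    (b : Fin (m + 1) → ℕ) (y : ∀ k, GhzSpace m k) :
    (outcomeSet o r b).indicator (ghzAssistedState (l, s)) (fun k => l.exchange k (y k)) =
      boolSign s * (outcomeSet o r b).indicator (ghzAssistedState (l, s)) y := by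
  classical
  have hexch := ghzAssistedState_exchange l s y
  rw [Set.indicator_apply, Set.indicator_apply, hexch, mul_ite, mul_zero]
  by_cases hy : ghzAssistedState (l, s) y = 0
  · simp only [hy, mul_zero, ite_self]
  have hsign : boolSign s ≠ 0 := left_ne_zero_of_mul_eq_one (boolSign_mul_self s)
  have hs := inSupport_of_ghzAssistedState_ne_zero hy
  have hs' := inSupport_of_ghzAssistedState_ne_zero (hexch.trans_ne (mul_ne_zero hsign hy))
  simp only [hs.mem_outcomeSet_iff, hs'.mem_outcomeSet_iff, hs.aliceComparison_exchange]

theorem perfectlyDistinguishable_ghzAssistedState :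
    PerfectlyDistinguishable fun x => pureState (ghzAssistedState (m := m) x) := by
  refine .of_measure aliceComparison fun o => ?_
  refine .of_measure (bobTest (o 0)) fun r => ?_
  refine .of_measure (aliceTest r) fun b => ?_
  simp only [Set.indicator_indicator]
  change PerfectlyDistinguishable fun x => pureState ((outcomeSet o r b).indicator _)
  have hname : ∀ {l s}, (outcomeSet o r b).indicator (ghzAssistedState (l, s)) ≠ 0 →
      l.bobOutcome = r ∧ l.aliceOutcome = b 0 := fun {l s} hne => by
    obtain ⟨y, hy⟩ := Function.ne_iff.1 hne
    obtain ⟨hmem, hy⟩ := Set.indicator_apply_ne_zero.1 hy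
    obtain ⟨-, hr, hb⟩ := (inSupport_of_ghzAssistedState_ne_zero hy).mem_outcomeSet_iff.1 hmem
    exact ⟨hr, (if_pos rfl).symm.trans (hb 0)⟩
  by_cases hl : ∃ l : GLabel m, l.bobOutcome = r ∧ l.aliceOutcome = b 0
  · obtain ⟨l, hr, hb⟩ := hl
    refine .of_involutive_perm l.exchange l.exchange_mul_self (fun s => (l, s)) (fun x hx => ?_)
      fun s => indicator_ghzAssistedState_exchange l s o r b
    by_contra hne
    obtain ⟨hr', hb'⟩ := hname hne
    exact hx x.2 (Prod.ext (GLabel.eq_of_outcomes_eq (hr'.trans hr.symm) (hb'.trans hb.symm)) rfl)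
  · refine .of_eq_zero (.zero, true) fun x _ => ?_
    have hzero : (outcomeSet o r b).indicator (ghzAssistedState x) = 0 := by
      by_contra hne
      exact hl ⟨x.1, hname hne⟩
    rw [hzero, pureState, Matrix.zero_vecMulVec]

end Protocol

theorem corollary2_general {m : ℕ} (hm : 1 ≤ m) {p : GLabel m × Bool → ℝ} (hp : ∀ x, 0 < p x)
    {S : Type} [Fintype S] [DecidableEq S] {d : S → ℕ}
    {ρ : Matrix (∀ s, Fin (d s)) (∀ s, Fin (d s)) ℂ} (hρ : IsDensity ρ) {own : S → Fin (m + 1)}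
    (hown : ¬ Function.Surjective own) :
    payoff p (gState m) own ρ <
      payoff (d := fun _ : Fin (m + 1) => 2) p (gState m) id (pureState (ghz (m + 1))) := by
  have : Nonempty (GLabel m × Bool) := ⟨(.zero, true)⟩
  calc payoff p (gState m) own ρ < ∑ x, p x :=
        payoff_lt_sum hp (fun x => (isDensity_pureState_gState x).jointState own hρ) (by norm_num)
          (le_error_gState hm hρ hown)
    _ ≤ payoff (d := fun _ : Fin (m + 1) => 2) p (gState m) id (pureState (ghz (m + 1))) := by
        refine PerfectlyDistinguishable.sum_le_payoff (fun x => (hp x).le) (fun x =>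
          (isDensity_pureState_gState x).jointState id (isDensity_pureState_ghz m)) ?_
        simp only [jointState_pureState]
        exact perfectlyDistinguishable_ghzAssistedState

theorem corollary2 (m : ℕ) (hm : 1 ≤ m)
    (p : GLabel m × Bool → ℝ) (hp : ∀ x, 0 < p x) (hp1 : ∑ x, p x = 1)
    (d : Fin m → ℕ) (ρ : Matrix (∀ s, Fin (d s)) (∀ s, Fin (d s)) ℂ) (hρ : IsDensity ρ)
    (own : Fin m → Fin (m + 1)) :
    payoff (d := fun _ : Fin (m + 1) => 2) p (gState m) id (pureState (ghz (m + 1))) >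
      payoff p (gState m) own ρ :=
  corollary2_general hm hp hρ fun hown => by simpa using Fintype.card_le_of_surjective own hown
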